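/- Let $k<0$ and $p^+,p^-\in\mathbb{R}$. Let $\widehat{\mathfrak{nw}}$ be the affine Nappi--Witten algebra at level $k$ (with $b=2/k$), i.e. the complex Lie algebra generated by modes $J^{+}_n,J^-_n,J_n,T_n$ ($n\in\mathbb{Z}$) with $$[J^+_m,J^-_n]=2iT_{m+n}+km\,\delta_{m+n,0},\quad [J_m,J^\pm_n]=\pm iJ^\pm_{m+n},\quad [J_m,T_n]=\tfrac{k}{2}m\,\delta_{m+n,0},\quad [J_m,J_n]=\tfrac{kb}{2}m\,\delta_{m+n,0}=m\,\delta_{m+n,0},$$ all other commutators of modes being zero (the central element acts as the number $k$). Let $\widehat V_+^{p^+,p^-}$ (respectively $\widehat V_-^{p^+,p^-}$) be the Verma module generated by a vector $|p^+,p^-\rangle$ subject to: it is annihilated by all modes $J^\pm_n,J_n,T_n$ with $n>0$ and by $J^+_0$ (respectively $J^-_0$), and $T_0|p^+,p^-\rangle=ip^+|p^+,p^-\rangle$, $J_0|p^+,p^-\rangle=ip^-|p^+,p^-\rangle$. On each of the modules considered below there is exactly one Hermitian form $\langle\cdot|\cdot\rangle$ with $\langle p^+,p^-|p^+,p^-\rangle=1$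 for which $(J^\pm_n)^\dagger=-J^\mp_{-n}$, $J_n^\dagger=-J_{-n}$, $T_n^\dagger=-T_{-n}$; the norm of a state $\psi$ means $\langle\psi|\psi\rangle$. Put $X_n=J_n-T_n$. Then: 1. if $0<p^+\le -k/2$, every $\psi\in\widehat V_+^{p^+,p^-}$ with $X_n\psi=0$ for all $n>0$ has non-negative norm; 2. if $k/2\le p^+<0$, every $\psi\in\widehat V_-^{p^+,p^-}$ with $X_n\psi=0$ for all $n>0$ has non-negative norm. -/

import Mathlib

namespace NappiWitten

/-- The modes `J⁺ₙ`, `J⁻ₙ`, `Jₙ`, `Tₙ` (`n ∈ ℤ`) of the four Nappi–Witten currents. -/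
inductive Mode : Type
  | Jp (n : ℤ)
  | Jm (n : ℤ)
  | J (n : ℤ)
  | T (n : ℤ)

/-- The free associative unital complex algebra on the modes. -/
abbrev FreeModes : Type := FreeAlgebra ℂ Mode

/-- A mode, as an element of the free algebra. -/
abbrev FreeModes.of (g : Mode) : FreeModes := FreeAlgebra.ι ℂ g

/-- The central term `c δ_{m+n,0}`. -/
noncomputable def central (c : ℝ) (m n : ℤ) : FreeModes :=
  if m + n = 0 then algebraMap ℂ FreeModes (c : ℂ) else 0

open FreeModes in
/-- The commutation relations of the affine Nappi–Witten algebra at level `k`, for the invariant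
form with parameter `b`; the central element is set equal to the number `k`. -/
inductive CommRel (k b : ℝ) : FreeModes → FreeModes → Prop
  | Jp_Jm (m n : ℤ) : CommRel k b
      (of (.Jp m) * of (.Jm n) - of (.Jm n) * of (.Jp m))
      ((2 * Complex.I) • of (.T (m + n)) + central (k * m) m n)
  | J_Jp (m n : ℤ) : CommRel k b
      (of (.J m) * of (.Jp n) - of (.Jp n) * of (.J m)) (Complex.I • of (.Jp (m + n)))
  | J_Jm (m n : ℤ) : CommRel k b
      (of (.J m) * of (.Jm n) - of (.Jm n) * of (.J m)) (-(Complex.I • of (.Jm (m + n))))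
  | J_T (m n : ℤ) : CommRel k b
      (of (.J m) * of (.T n) - of (.T n) * of (.J m)) (central (k / 2 * m) m n)
  | J_J (m n : ℤ) : CommRel k b
      (of (.J m) * of (.J n) - of (.J n) * of (.J m)) (central (k * b / 2 * m) m n)
  | Jp_Jp (m n : ℤ) : CommRel k b
      (of (.Jp m) * of (.Jp n) - of (.Jp n) * of (.Jp m)) 0
  | Jm_Jm (m n : ℤ) : CommRel k b
      (of (.Jm m) * of (.Jm n) - of (.Jm n) * of (.Jm m)) 0
  | T_Jp (m n : ℤ) : CommRel k b
      (of (.T m) * of (.Jp n) - of (.Jp n) * of (.T m)) 0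
  | T_Jm (m n : ℤ) : CommRel k b
      (of (.T m) * of (.Jm n) - of (.Jm n) * of (.T m)) 0
  | T_T (m n : ℤ) : CommRel k b
      (of (.T m) * of (.T n) - of (.T n) * of (.T m)) 0

/-- The enveloping algebra of the affine Nappi–Witten algebra at level `k`: its left modules are
exactly the level `k` representations. -/
abbrev Env (k b : ℝ) : Type := RingQuot (CommRel k b)

/-- A mode, as an element of the enveloping algebra. -/
noncomputable def mode (k b : ℝ) (g : Mode) : Env k b :=
  RingQuot.mkAlgHom ℂ (CommRel k b) (FreeModes.of g)

/-- The two series of modules: highest weight (`+`) and lowest weight (`-`). -/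
inductive Series : Type
  | highest
  | lowest

/-- The zero mode that annihilates the highest (lowest) weight vector. -/
def Series.zeroMode : Series → Mode
  | .highest => .Jp 0
  | .lowest => .Jm 0

/-- The elements of the enveloping algebra that are required to annihilate the highest (lowest)
weight vector of weight `(p⁺, p⁻)`: all positive modes, the zero mode `J⁺₀` (resp. `J⁻₀`),
`T₀ - i p⁺` and `J₀ - i p⁻`. -/
inductive Annihilates (k b : ℝ) (s : Series) (pp pm : ℝ) : Env k b → Prop
  | Jp (n : ℤ) (hn : 0 < n) : Annihilates k b s pp pm (mode k b (.Jp n))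
  | Jm (n : ℤ) (hn : 0 < n) : Annihilates k b s pp pm (mode k b (.Jm n))
  | J (n : ℤ) (hn : 0 < n) : Annihilates k b s pp pm (mode k b (.J n))
  | T (n : ℤ) (hn : 0 < n) : Annihilates k b s pp pm (mode k b (.T n))
  | zero : Annihilates k b s pp pm (mode k b s.zeroMode)
  | T_zero : Annihilates k b s pp pm
      (mode k b (.T 0) - algebraMap ℂ (Env k b) (Complex.I * pp))
  | J_zero : Annihilates k b s pp pm
      (mode k b (.J 0) - algebraMap ℂ (Env k b) (Complex.I * pm))

/-- The left ideal generated by the elements annihilating the weight vector. -/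
def annIdeal (k b : ℝ) (s : Series) (pp pm : ℝ) : Submodule (Env k b) (Env k b) :=
  Submodule.span (Env k b) {x | Annihilates k b s pp pm x}

/-- The Verma module with highest (lowest) weight `(p⁺, p⁻)`. -/
abbrev Verma (k b : ℝ) (s : Series) (pp pm : ℝ) : Type := Env k b ⧸ annIdeal k b s pp pm

/-- The highest (lowest) weight vector `|p⁺, p⁻⟩`. -/
def vac (k b : ℝ) (s : Series) (pp pm : ℝ) : Verma k b s pp pm :=
  (annIdeal k b s pp pm).mkQ 1

/-- The adjoint of the mode `g` is `-g.conj`: `(J^±ₙ)† = -J^∓₋ₙ`, `Jₙ† = -J₋ₙ`, `Tₙ† = -T₋ₙ`. -/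
def Mode.conj : Mode → Mode
  | .Jp n => .Jm (-n)
  | .Jm n => .Jp (-n)
  | .J n => .J (-n)
  | .T n => .T (-n)

/-- `B` is the inner product of the module: the Hermitian form, conjugate linear in the first
argument, for which the modes have the prescribed adjoints and the weight vector has norm one.
It need not be positive. -/
structure IsInnerProduct {k b : ℝ} {s : Series} {pp pm : ℝ}
    (B : Verma k b s pp pm →ₗ⋆[ℂ] Verma k b s pp pm →ₗ[ℂ] ℂ) : Prop where
  hermitian : ∀ x y, starRingEnd ℂ (B x y) = B y x
  adjoint : ∀ (g : Mode) x y, B (mode k b g • x) y = -B x (mode k b g.conj • y)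
  normalized : B (vac k b s pp pm) (vac k b s pp pm) = 1

/-- The modes `Xₙ = Jₙ - Tₙ` of the timelike `û(1)` current. -/
noncomputable def X (k b : ℝ) (n : ℤ) : Env k b := mode k b (.J n) - mode k b (.T n)

/-- `ψ` is a `û(1)`-primary state. -/
def IsPrimary {k b : ℝ} {s : Series} {pp pm : ℝ} (ψ : Verma k b s pp pm) : Prop :=
  ∀ n : ℤ, 0 < n → X k b n • ψ = 0

/-- The module carries exactly one inner product, and no `û(1)`-primary state has negative norm
with respect to it. -/
def CosetUnitary (k b : ℝ) (s : Series) (pp pm : ℝ) : Prop :=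
  ∃ B : Verma k b s pp pm →ₗ⋆[ℂ] Verma k b s pp pm →ₗ[ℂ] ℂ,
    IsInnerProduct B ∧ (∀ B', IsInnerProduct B' → B' = B) ∧
      ∀ ψ : Verma k b s pp pm, IsPrimary ψ → 0 ≤ (B ψ ψ).re

end NappiWitten

/-!
The Verma module is mapped to a Fock space on which its inner product is visible. On that space the
currents are built from two neutral free bosons `X` (timelike) and `Y` (spacelike) and a pair of
charged free fields: `T` is the null current `(Y - X) / (2 - b)`, `J = X + T`, and `J⁺`, `J⁻` are
the charged fields multiplied by the vertex operators `exp(∓(2i/k) ∑_{n ≠ 0} Tₙ zⁿ / n)`. Because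
`T` is null these vertex operators commute with each other and with the charged fields, and they
convert the commutators of the free fields into those of the affine Nappi–Witten algebra.

Monomials in the creation operators are orthogonal, and when `0 ≤ p⁺ ≤ -k/2` only those involving
oscillators of `X` can have negative norm. A primary state is annihilated by `Xₙ` for `n > 0`, so no
such monomial occurs in it. The lowest weight series is obtained from the highest weight series by
the automorphism that exchanges `J⁺` and `J⁻` and reverses the signs of `J` and `T`.
-/

namespace NappiWitten

attribute [local instance] LieRing.ofAssociativeRing

section PointwiseConvergence

theorem hasSum_antidiagonal {M : Type*} [AddCommMonoid M] [TopologicalSpace M] [ContinuousAdd M]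
    [RegularSpace M] {f : ℕ × ℕ → M} {a : M} (h : HasSum f a) :
    HasSum (fun n => ∑ p ∈ Finset.HasAntidiagonal.antidiagonal n, f p) a := by
  convert ((Equiv.hasSum_iff (f := f) Finset.HasAntidiagonal.sigmaAntidiagonalEquivProd).2
    h).sigma fun n => hasSum_fintype _ using 2 with n
  exact (Finset.sum_coe_sort (Finset.HasAntidiagonal.antidiagonal n) f).symm

variable {R V ι κ : Type*} [Semiring R] [AddCommGroup V] [Module R V] [TopologicalSpace V]

/-- The topology of pointwise convergence on the operators of `V`, in which all infinite sums of
operators are taken. For discrete `V` a series converges when it is finite on every vector. -/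
scoped instance pointwiseTopology : TopologicalSpace (Module.End R V) :=
  .induced (fun a : Module.End R V => (a : V → V)) inferInstance

theorem isInducing_coe_end : Topology.IsInducing (fun a : Module.End R V => (a : V → V)) :=
  ⟨rfl⟩

instance [T2Space V] : T2Space (Module.End R V) :=
  .of_injective_continuous DFunLike.coe_injective isInducing_coe_end.continuous

theorem hasSum_end_iff {f : ι → Module.End R V} {a : Module.End R V} :
    HasSum f a ↔ ∀ v, HasSum (fun i => f i v) (a v) := by
  rw [← Pi.hasSum, HasSum, HasSum, isInducing_coe_end.tendsto_nhds_iff]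
  congr! 1
  ext s v
  simp

theorem hasSum_end_mul_right {f : ι → Module.End R V} {a : Module.End R V} (hf : HasSum f a)
    (c : Module.End R V) : HasSum (fun i => f i * c) (a * c) :=
  hasSum_end_iff.2 fun v => hasSum_end_iff.1 hf (c v)

variable [DiscreteTopology V]

instance : IsTopologicalAddGroup (Module.End R V) :=
  topologicalAddGroup_induced (LinearMap.ltoFun R V V ℕ)

theorem summable_end_iff {f : ι → Module.End R V} :
    Summable f ↔ ∀ v, Summable fun i => f i v := by
  refine ⟨fun h v => ((hasSum_end_iff.1 h.hasSum) v).summable, fun h => ?_⟩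
  have : ContinuousConstSMul R V := ⟨fun _ => continuous_of_discreteTopology⟩
  let a : Module.End R V :=
    { toFun := fun v => ∑' i, f i v
      map_add' := fun v w => by simp only [map_add, (h v).tsum_add (h w)]
      map_smul' := fun c v => by simp only [map_smul, (h v).tsum_const_smul c, RingHom.id_apply] }
  exact ⟨a, hasSum_end_iff.2 fun v => (h v).hasSum⟩

theorem hasSum_end_mul_left {f : ι → Module.End R V} {a : Module.End R V} (hf : HasSum f a)
    (c : Module.End R V) : HasSum (fun i => c * f i) (c * a) :=
  hasSum_end_iff.2 fun v => (hasSum_end_iff.1 hf v).map c continuous_of_discreteTopology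

theorem hasSum_end_mul {f : ι → Module.End R V} {g : κ → Module.End R V} {a c : Module.End R V}
    (hf : HasSum f a) (hg : HasSum g c) : HasSum (fun p : ι × κ => f p.1 * g p.2) (a * c) := by
  have h_finite : ∀ v, (Function.support fun p : κ × ι => (f p.2 * g p.1) v).Finite := by
    intro v
    have hJ := (hasSum_end_iff.1 hg v).summable.hasFiniteSupport_of_discreteTopology
    refine (hJ.biUnion fun j _ => ((hasSum_end_iff.1 hf (g j v)).summable
      |>.hasFiniteSupport_of_discreteTopology).image fun i => (j, i)).subset fun ⟨j, i⟩ hp => ?_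
    have hj : g j v ≠ 0 := fun h => hp (by simp [h])
    exact Set.mem_biUnion hj ⟨i, hp, rfl⟩
  have h_sum : Summable fun p : κ × ι => f p.2 * g p.1 :=
    summable_end_iff.2 fun v => summable_of_hasFiniteSupport (h_finite v)
  rw [(hasSum_end_mul_left hg a).unique
    (h_sum.hasSum.prod_fiberwise fun j => hasSum_end_mul_right hf (g j))]
  exact (Equiv.hasSum_iff (f := fun p : κ × ι => f p.2 * g p.1) (Equiv.prodComm ι κ)).2 h_sum.hasSum

theorem hasSum_end_lie {f : ι → Module.End R V} {g : κ → Module.End R V} {a c : Module.End R V}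
    (hf : HasSum f a) (hg : HasSum g c) : HasSum (fun p : ι × κ => ⁅f p.1, g p.2⁆) ⁅a, c⁆ :=
  (hasSum_end_mul hf hg).sub
    ((Equiv.hasSum_iff (f := fun p : κ × ι => g p.1 * f p.2) (Equiv.prodComm ι κ)).2
      (hasSum_end_mul hg hf))

theorem hasSum_end_lie_left {g : κ → Module.End R V} {c : Module.End R V}
    (a : Module.End R V) (hg : HasSum g c) : HasSum (fun i => ⁅a, g i⁆) ⁅a, c⁆ :=
  (hasSum_end_mul_left hg a).sub (hasSum_end_mul_right hg a)

theorem commute_of_hasSum {g : κ → Module.End R V} {a c : Module.End R V}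
    (hg : HasSum g c) (h : ∀ i, Commute a (g i)) : Commute a c :=
  (hasSum_end_mul_left hg a).unique (by simpa only [(h _).eq] using hasSum_end_mul_right hg a)

end PointwiseConvergence

section ExponentialSeries

open PowerSeries Finset

variable {A : Type*} [Ring A]

/-- The Euler operator `z d/dz` on power series. -/
noncomputable def euler : A⟦X⟧ →+ A⟦X⟧ where
  toFun F := PowerSeries.mk fun n => n • coeff n F
  map_zero' := by ext; simp
  map_add' F G := by ext; simp

theorem coeff_euler (n : ℕ) (F : A⟦X⟧) : coeff n (euler F) = n • coeff n F := by
  rw [euler, AddMonoidHom.coe_mk, ZeroHom.coe_mk, coeff_mk]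

theorem euler_mul (F G : A⟦X⟧) : euler (F * G) = euler F * G + F * euler G := by
  ext n
  rw [coeff_euler, map_add, coeff_mul, coeff_mul, coeff_mul, smul_sum, ← sum_add_distrib]
  refine sum_congr rfl fun p hp => ?_
  rw [coeff_euler, coeff_euler, ← mem_antidiagonal.1 hp, add_smul, smul_mul_assoc, mul_smul_comm]

theorem euler_X_pow (p : ℕ) : euler (PowerSeries.X ^ p : A⟦X⟧) = p • PowerSeries.X ^ p := by
  ext n
  rw [coeff_euler, map_nsmul, coeff_X_pow]
  split_ifs with h <;> simp [h]

theorem coeff_lie_C (D : A) (F : A⟦X⟧) (n : ℕ) : coeff n ⁅C D, F⁆ = ⁅D, coeff n F⁆ := by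
  rw [Ring.lie_def, Ring.lie_def, map_sub, coeff_C_mul, coeff_mul_C]

theorem euler_lie_C (D : A) (F : A⟦X⟧) : euler ⁅C D, F⁆ = ⁅C D, euler F⁆ := by
  ext n
  rw [coeff_euler, coeff_lie_C, coeff_lie_C, coeff_euler, Ring.lie_def, Ring.lie_def, smul_sub,
    mul_smul_comm, smul_mul_assoc]

theorem commute_of_coeff {F G : A⟦X⟧} (h : ∀ i j, Commute (coeff i F) (coeff j G)) :
    Commute F G := by
  ext n
  rw [coeff_mul, coeff_mul, ← Nat.sum_antidiagonal_swap]
  exact sum_congr rfl fun p _ => h _ _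

theorem eq_zero_of_euler_eq_mul (𝕜 : Type*) [Field 𝕜] [CharZero 𝕜] [Algebra 𝕜 A] {u H : A⟦X⟧}
    (hu : coeff 0 u = 0) (h : euler H = u * H) (h_zero : coeff 0 H = 0) : H = 0 := by
  ext n
  induction n using Nat.strong_induction_on with
  | _ n ih =>
    rcases n with _ | n
    · exact h_zero
    have h_coeff : ((n + 1 : ℕ) : 𝕜) • coeff (n + 1) H = 0 := by
      rw [Nat.cast_smul_eq_nsmul, ← coeff_euler, h, coeff_mul, Nat.sum_antidiagonal_succ, hu,
        zero_mul, zero_add]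
      refine sum_eq_zero fun p hp => ?_
      rw [ih p.2 (by have := mem_antidiagonal.1 hp; omega), map_zero, mul_zero]
    exact (smul_eq_zero_iff_right (Nat.cast_ne_zero.2 n.succ_ne_zero)).1 h_coeff

variable (𝕜 : Type*) [Field 𝕜] [Algebra 𝕜 A]

/-- The coefficients of `expSeries`. -/
noncomputable def expCoeff (u : A⟦X⟧) : ℕ → A
  | 0 => 1
  | n + 1 => ((n + 1 : ℕ) : 𝕜)⁻¹ • ∑ i : Fin (n + 1), coeff (n - i + 1) u * expCoeff u i

/-- The solution of `z E' = u E` with constant term `1`, where `u` has no constant term. If the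
coefficients of `u` commute, this is the exponential of `∑ uₗ zˡ / l`. -/
noncomputable def expSeries (u : A⟦X⟧) : A⟦X⟧ := PowerSeries.mk (expCoeff 𝕜 u)

theorem coeff_zero_expSeries (u : A⟦X⟧) : coeff 0 (expSeries 𝕜 u) = 1 := by
  rw [expSeries, coeff_mk, expCoeff]

theorem coeff_succ_expSeries (u : A⟦X⟧) (n : ℕ) : coeff (n + 1) (expSeries 𝕜 u) =
    ((n + 1 : ℕ) : 𝕜)⁻¹ • ∑ p ∈ antidiagonal n,
      coeff (p.1 + 1) u * coeff p.2 (expSeries 𝕜 u) := by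
  rw [expSeries, coeff_mk, expCoeff, ← Nat.sum_antidiagonal_swap,
    Nat.sum_antidiagonal_eq_sum_range_succ_mk, sum_range]
  simp only [Prod.fst_swap, Prod.snd_swap, coeff_mk]

variable {𝕜} [CharZero 𝕜] {u : A⟦X⟧}

theorem euler_expSeries (hu : coeff 0 u = 0) :
    euler (expSeries 𝕜 u) = u * expSeries 𝕜 u := by
  ext n
  rcases n with _ | n
  · simp [coeff_euler, coeff_mul, hu]
  · rw [coeff_euler, coeff_succ_expSeries, coeff_mul, Nat.sum_antidiagonal_succ, hu, zero_mul,
      zero_add, ← Nat.cast_smul_eq_nsmul 𝕜, smul_inv_smul₀ (Nat.cast_ne_zero.2 n.succ_ne_zero)]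

theorem lie_coeff_expSeries {D : A} {c : 𝕜} {p : ℕ} (hu : coeff 0 u = 0) (hp : p ≠ 0)
    (h : ∀ l, ⁅D, coeff l u⁆ = if l = p then (p * c) • 1 else 0) (n : ℕ) :
    ⁅D, coeff n (expSeries 𝕜 u)⁆ = if p ≤ n then c • coeff (n - p) (expSeries 𝕜 u) else 0 := by
  set E := expSeries 𝕜 u
  have h_lie_u : ⁅C D, u⁆ = (p * c) • PowerSeries.X ^ p := by
    ext l
    rw [coeff_lie_C, h, LinearMap.map_smul_of_tower, coeff_X_pow, smul_ite, smul_zero]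
  have h_euler : euler (⁅C D, E⁆ - c • (PowerSeries.X ^ p * E)) =
      u * (⁅C D, E⁆ - c • (PowerSeries.X ^ p * E)) := by
    have h_smul : euler (c • (PowerSeries.X ^ p * E)) = c • euler (PowerSeries.X ^ p * E) := by
      ext l
      rw [coeff_euler, LinearMap.map_smul_of_tower, LinearMap.map_smul_of_tower, coeff_euler,
        smul_comm]
    rw [map_sub, euler_lie_C, h_smul, euler_mul, euler_X_pow, euler_expSeries hu,
      Ring.lie_def (C D) (u * E)]
    have h_X : u * (PowerSeries.X ^ p * E) = PowerSeries.X ^ p * (u * E) := by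
      rw [← mul_assoc, ← mul_assoc, (PowerSeries.commute_X_pow u p).eq]
    have h_leibniz : C D * (u * E) - u * E * C D = ⁅C D, u⁆ * E + u * ⁅C D, E⁆ := by
      rw [Ring.lie_def, Ring.lie_def]
      noncomm_ring
    rw [h_leibniz, h_lie_u, mul_sub, mul_smul_comm, h_X, smul_mul_assoc, smul_mul_assoc,
      ← Nat.cast_smul_eq_nsmul 𝕜]
    module
  have h_zero : coeff 0 (⁅C D, E⁆ - c • (PowerSeries.X ^ p * E)) = 0 := by
    rw [map_sub, coeff_lie_C, LinearMap.map_smul_of_tower, coeff_X_pow_mul', if_neg (by omega),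
      coeff_zero_expSeries, Ring.lie_def]
    simp
  have h_eq := sub_eq_zero.1 (eq_zero_of_euler_eq_mul 𝕜 hu h_euler h_zero)
  rw [← coeff_lie_C, h_eq, LinearMap.map_smul_of_tower, coeff_X_pow_mul', smul_ite, smul_zero]

theorem commute_coeff_expSeries {D : A} (hu : coeff 0 u = 0) (h : ∀ l, Commute D (coeff l u))
    (n : ℕ) : Commute D (coeff n (expSeries 𝕜 u)) := by
  rw [commute_iff_lie_eq, lie_coeff_expSeries (c := 0) hu one_ne_zero]
  · simp
  · intro l
    rw [commute_iff_lie_eq.1 (h l)]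
    simp

theorem expSeries_mul_expSeries_neg (hu : coeff 0 u = 0)
    (h : ∀ i j, Commute (coeff i u) (coeff j u)) : expSeries 𝕜 u * expSeries 𝕜 (-u) = 1 := by
  have hu' : coeff 0 (-u) = 0 := by rw [map_neg, hu, neg_zero]
  have h_comm : Commute u (expSeries 𝕜 u) :=
    commute_of_coeff fun i _ => commute_coeff_expSeries hu (h i) _
  rw [← sub_eq_zero]
  refine eq_zero_of_euler_eq_mul 𝕜 (u := 0) (map_zero _) ?_ ?_
  · have h_one : euler (1 : A⟦X⟧) = 0 := by simpa using euler_X_pow (A := A) 0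
    rw [map_sub, euler_mul, euler_expSeries hu, euler_expSeries hu', h_one, h_comm.eq]
    noncomm_ring
  · rw [map_sub, coeff_mul, Nat.antidiagonal_zero, sum_singleton, coeff_zero_expSeries,
      coeff_zero_expSeries, coeff_zero_one, mul_one, sub_self]

theorem sum_smul_coeff_expSeries_mul (hu : coeff 0 u = 0)
    (h : ∀ i j, Commute (coeff i u) (coeff j u)) (n : ℕ) :
    ∑ p ∈ antidiagonal n, p.1 • (coeff p.1 (expSeries 𝕜 u) * coeff p.2 (expSeries 𝕜 (-u))) =
      coeff n u := by
  have h_mul : euler (expSeries 𝕜 u) * expSeries 𝕜 (-u) = u := by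
    rw [euler_expSeries hu, mul_assoc, expSeries_mul_expSeries_neg hu h, mul_one]
  simpa only [coeff_mul, coeff_euler, smul_mul_assoc] using congrArg (coeff n) h_mul

end ExponentialSeries

section ExponentialOperators

open PowerSeries Finset

theorem coeff_expSeries_mem {𝕜 V : Type*} [Field 𝕜] [AddCommGroup V] [Module 𝕜 V]
    {u : (Module.End 𝕜 V)⟦X⟧} {F : ℕ → Submodule 𝕜 V}
    (h : ∀ l d, ∀ v ∈ F d, coeff (l + 1) u v ∈ F (d - (l + 1))) (n d : ℕ) :
    ∀ v ∈ F d, coeff n (expSeries 𝕜 u) v ∈ F (d - n) := by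
  induction n using Nat.strong_induction_on with
  | _ n ih =>
    intro v hv
    rcases n with _ | n
    · simpa [coeff_zero_expSeries, -coeff_zero_eq_constantCoeff] using hv
    rw [coeff_succ_expSeries, LinearMap.smul_apply, LinearMap.sum_apply]
    refine Submodule.smul_mem _ _ (Submodule.sum_mem _ fun p hp => ?_)
    have hp' := mem_antidiagonal.1 hp
    have h_mem := h p.1 _ _ (ih p.2 (by omega) v hv)
    rwa [show d - p.2 - (p.1 + 1) = d - (n + 1) by omega] at h_mem

variable {V : Type*} [AddCommGroup V] [Module ℂ V]

/-- The operators `a` and `a'` are adjoint to each other with respect to the form `B`. -/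
def IsFormAdjoint (B : V →ₗ⋆[ℂ] V →ₗ[ℂ] ℂ) (a a' : Module.End ℂ V) : Prop :=
  ∀ x y, B (a x) y = B x (a' y)

namespace IsFormAdjoint

variable {ι : Type*} {B : V →ₗ⋆[ℂ] V →ₗ[ℂ] ℂ} {a a' c c' : Module.End ℂ V}

theorem one : IsFormAdjoint B 1 1 := fun _ _ => rfl

theorem add (ha : IsFormAdjoint B a a') (hc : IsFormAdjoint B c c') :
    IsFormAdjoint B (a + c) (a' + c') := fun x y => by
  simp only [LinearMap.add_apply, map_add, ha x y, hc x y]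

theorem smul (ha : IsFormAdjoint B a a') (z : ℂ) :
    IsFormAdjoint B (z • a) (starRingEnd ℂ z • a') := fun x y => by
  simp only [LinearMap.smul_apply, map_smulₛₗ, ha x y, RingHom.id_apply]

theorem neg (ha : IsFormAdjoint B a a') : IsFormAdjoint B (-a) (-a') := fun x y => by
  simp only [LinearMap.neg_apply, map_neg, ha x y]

theorem add_neg (ha : IsFormAdjoint B a (-a')) (hc : IsFormAdjoint B c (-c')) :
    IsFormAdjoint B (a + c) (-(a' + c')) := by
  rw [neg_add]
  exact ha.add hc

theorem smul_I (ha : IsFormAdjoint B a a) :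
    IsFormAdjoint B (Complex.I • a) (-(Complex.I • a)) := by
  have h := ha.smul Complex.I
  rwa [Complex.conj_I, neg_smul] at h

theorem smul_sub_neg (ha : IsFormAdjoint B a (-a')) (hc : IsFormAdjoint B c (-c')) (r : ℝ) :
    IsFormAdjoint B ((r : ℂ) • (a - c)) (-((r : ℂ) • (a' - c'))) := fun x y => by
  have ha' := ha x y
  have hc' := hc x y
  simp only [LinearMap.neg_apply, map_neg] at ha' hc'
  simp only [LinearMap.smul_apply, LinearMap.sub_apply, LinearMap.neg_apply, map_smulₛₗ, map_sub,
    map_neg, ha', hc', Complex.conj_ofReal, RingHom.id_apply, smul_eq_mul]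
  ring

theorem mul (ha : IsFormAdjoint B a a') (hc : IsFormAdjoint B c c') :
    IsFormAdjoint B (a * c) (c' * a') := fun x y => by
  rw [Module.End.mul_apply, Module.End.mul_apply, ha, hc]

theorem sum {s : Finset ι} {f f' : ι → Module.End ℂ V} (h : ∀ i ∈ s, IsFormAdjoint B (f i) (f' i)) :
    IsFormAdjoint B (∑ i ∈ s, f i) (∑ i ∈ s, f' i) := fun x y => by
  simp only [LinearMap.sum_apply, map_sum]
  exact sum_congr rfl fun i hi => h i hi x y

theorem of_hasSum [TopologicalSpace V] [DiscreteTopology V] {f f' : ι → Module.End ℂ V}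
    (hf : HasSum f a) (hf' : HasSum f' a') (h : ∀ i, IsFormAdjoint B (f i) (f' i)) :
    IsFormAdjoint B a a' := fun x y => by
  have h_left := (hasSum_end_iff.1 hf x).map (B.flip y) continuous_of_discreteTopology
  have h_right := (hasSum_end_iff.1 hf' y).map (B x) continuous_of_discreteTopology
  simp only [Function.comp_def, ← h _ x y] at h_right
  exact h_left.unique h_right

theorem coeff_expSeries {u w : (Module.End ℂ V)⟦X⟧} (hw : coeff 0 w = 0)
    (hw_comm : ∀ i j, Commute (coeff i w) (coeff j w))
    (h : ∀ l, IsFormAdjoint B (coeff l u) (coeff l w)) (n : ℕ) :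
    IsFormAdjoint B (coeff n (expSeries ℂ u)) (coeff n (expSeries ℂ w)) := by
  induction n using Nat.strong_induction_on with
  | _ n ih =>
    rcases n with _ | n
    · rw [coeff_zero_expSeries, coeff_zero_expSeries]
      exact one
    have h_sum : ∑ p ∈ antidiagonal n, coeff (p.1 + 1) w * coeff p.2 (expSeries ℂ w) =
        ∑ p ∈ antidiagonal n, coeff p.2 (expSeries ℂ w) * coeff (p.1 + 1) w :=
      sum_congr rfl fun p _ => commute_coeff_expSeries hw (hw_comm _) _
    have h_conj : ((n + 1 : ℕ) : ℂ)⁻¹ = starRingEnd ℂ ((n + 1 : ℕ) : ℂ)⁻¹ := by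
      rw [map_inv₀, Complex.conj_natCast]
    rw [coeff_succ_expSeries, coeff_succ_expSeries, h_sum]
    nth_rewrite 2 [h_conj]
    exact (sum fun p hp =>
      (h _).mul (ih p.2 (by have := mem_antidiagonal.1 hp; omega))).smul _

end IsFormAdjoint

end ExponentialOperators

section VertexOperators

open PowerSeries Finset

variable {V : Type*} [AddCommGroup V] [Module ℂ V] {k η : ℝ} {ε : ℤˣ}
  {T : ℤ → Module.End ℂ V}

/-- The exponent `∓(2iη/k) ∑ Tₗ zˡ` of the vertex operator of charge `η`, restricted to the modes
`T_{εl}` with `l > 0`. -/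
noncomputable def vertexExponent (k : ℝ) (T : ℤ → Module.End ℂ V) (ε : ℤˣ) (η : ℝ) :
    (Module.End ℂ V)⟦X⟧ :=
  PowerSeries.mk fun l => if l = 0 then 0 else -((ε : ℤ) * (2 * Complex.I * η / k)) • T (ε * l)

/-- The modes of the half of the vertex operator `exp(-(2iη/k) ∑_{n ≠ 0} Tₙ zⁿ / n)` that involves
the modes `T_{εl}` with `l > 0`. -/
noncomputable def vertexOp (k : ℝ) (T : ℤ → Module.End ℂ V) (ε : ℤˣ) (η : ℝ) (j : ℕ) :
    Module.End ℂ V :=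
  coeff j (expSeries ℂ (vertexExponent k T ε η))

theorem coeff_vertexExponent (l : ℕ) : coeff l (vertexExponent k T ε η) =
    if l = 0 then 0 else -((ε : ℤ) * (2 * Complex.I * η / k)) • T (ε * l) := by
  rw [vertexExponent, coeff_mk]

theorem coeff_zero_vertexExponent : coeff 0 (vertexExponent k T ε η) = 0 := by
  rw [coeff_vertexExponent, if_pos rfl]

theorem vertexExponent_neg : vertexExponent k T ε (-η) = -vertexExponent k T ε η := by
  ext1 l
  rw [map_neg, coeff_vertexExponent, coeff_vertexExponent]
  split_ifs
  · rw [neg_zero]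
  · rw [← neg_smul]
    push_cast
    ring_nf

theorem commute_coeff_vertexExponent {D : Module.End ℂ V} (h : ∀ n, Commute D (T n)) (l : ℕ) :
    Commute D (coeff l (vertexExponent k T ε η)) := by
  rw [coeff_vertexExponent]
  split_ifs
  · exact Commute.zero_right _
  · exact (h _).smul_right _

theorem commute_vertexOp {D : Module.End ℂ V} (h : ∀ n, Commute D (T n)) (j : ℕ) :
    Commute D (vertexOp k T ε η j) :=
  commute_coeff_expSeries coeff_zero_vertexExponent (commute_coeff_vertexExponent h) j

theorem commute_vertexOp_vertexOp (hT : ∀ m n, Commute (T m) (T n)) (ε' : ℤˣ) (η' : ℝ) (i j : ℕ) :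
    Commute (vertexOp k T ε η i) (vertexOp k T ε' η' j) :=
  commute_vertexOp (fun n => (commute_vertexOp (hT n) i).symm) j

theorem vertexOp_zero : vertexOp k T ε η 0 = 1 := coeff_zero_expSeries ℂ _

theorem sum_vertexOp_mul_vertexOp_neg (hT : ∀ m n, Commute (T m) (T n)) (s : ℕ) :
    ∑ p ∈ antidiagonal s, vertexOp k T ε η p.1 * vertexOp k T ε (-η) p.2 =
      if s = 0 then 1 else 0 := by
  have h_mul := expSeries_mul_expSeries_neg (𝕜 := ℂ) (u := vertexExponent k T ε η)
    coeff_zero_vertexExponent fun i j =>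
      commute_coeff_vertexExponent (fun n => (commute_coeff_vertexExponent (hT n) i).symm) j
  rw [← vertexExponent_neg] at h_mul
  rw [← coeff_one, ← h_mul, coeff_mul]
  rfl

theorem sum_smul_vertexOp_mul_vertexOp_neg (hT : ∀ m n, Commute (T m) (T n)) (s : ℕ) :
    ∑ p ∈ antidiagonal s, p.1 • (vertexOp k T ε η p.1 * vertexOp k T ε (-η) p.2) =
      coeff s (vertexExponent k T ε η) := by
  simp only [vertexOp, vertexExponent_neg]
  exact sum_smul_coeff_expSeries_mul coeff_zero_vertexExponent
    (fun i j =>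
      commute_coeff_vertexExponent (fun n => (commute_coeff_vertexExponent (hT n) i).symm) j) s

theorem sum_vertexOp_mul_vertexOp_neg_mul_smul_one (hk : k ≠ 0) (hT : ∀ m n, Commute (T m) (T n))
    (m : ℤ) (s : ℕ) :
    ∑ p ∈ antidiagonal s, vertexOp k T ε η p.1 * vertexOp k T ε (-η) p.2 *
        ((k * (m - ε * p.1 : ℤ) : ℂ) • 1) =
      if s = 0 then (k * m : ℂ) • 1 else (2 * Complex.I * η) • T (ε * s) := by
  have h_split : ∀ p : ℕ × ℕ, vertexOp k T ε η p.1 * vertexOp k T ε (-η) p.2 *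
      ((k * (m - ε * p.1 : ℤ) : ℂ) • 1) =
      (k * m : ℂ) • (vertexOp k T ε η p.1 * vertexOp k T ε (-η) p.2) +
        (-(k * (ε : ℤ)) : ℂ) • p.1 • (vertexOp k T ε η p.1 * vertexOp k T ε (-η) p.2) := by
    intro p
    rw [mul_smul_one, ← Nat.cast_smul_eq_nsmul ℂ, smul_smul, ← add_smul]
    push_cast
    ring_nf
  have hε : ((ε : ℤ) : ℂ) * (ε : ℤ) = 1 := by
    rcases Int.units_eq_one_or ε with rfl | rfl <;> simp
  have hk' : (k : ℂ) ≠ 0 := Complex.ofReal_ne_zero.2 hk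
  simp only [h_split, sum_add_distrib, ← smul_sum, sum_vertexOp_mul_vertexOp_neg hT,
    sum_smul_vertexOp_mul_vertexOp_neg hT, coeff_vertexExponent]
  split_ifs
  · rw [smul_zero, add_zero]
  · rw [smul_zero, zero_add, smul_smul]
    congr 1
    field_simp
    linear_combination (η : ℂ) * hε

/-- The product of the two vertex operators is `1`, and its derivative, which comes from the factor
`m - εp` of the central term, produces the modes of `T`. -/
theorem sum_vertexOp_mul_vertexOp_neg_mul {Θ : ℤ → Module.End ℂ V} (hk : k ≠ 0)
    (hT : ∀ m n, Commute (T m) (T n)) (m N : ℤ) (s : ℕ) :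
    ∑ p ∈ antidiagonal s, vertexOp k T ε η p.1 * vertexOp k T ε (-η) p.2 *
        (Θ (N - ε * s) + if N - ε * s = 0 then (k * (m - ε * p.1 : ℤ) : ℂ) • 1 else 0) =
      (if s = 0 then Θ N + if N = 0 then (k * m : ℂ) • 1 else 0 else 0) +
        if s = (ε * N).toNat then
          if 0 < ε * N then (2 * Complex.I * η) • T N else 0 else 0 := by
  have h_iff : N - ε * s = 0 ↔ ε * N = s := by
    rcases Int.units_eq_one_or ε with rfl | rfl <;> simp <;> omega
  simp only [mul_add, sum_add_distrib, ← sum_mul, sum_vertexOp_mul_vertexOp_neg hT]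
  by_cases hN : ε * N = s
  · have hN' : N = ε * s := sub_eq_zero.1 (h_iff.2 hN)
    simp only [if_pos (h_iff.2 hN), sum_vertexOp_mul_vertexOp_neg_mul_smul_one hk hT]
    simp only [hN, Int.toNat_natCast, if_true, ← hN']
    rcases eq_or_ne s 0 with rfl | hs
    · obtain rfl : N = 0 := by simpa using hN'
      simp
    · simp [hs, Nat.pos_of_ne_zero hs]
  · have h_toNat : ¬(s = (ε * N).toNat ∧ 0 < ε * N) := by omega
    simp only [if_neg (mt h_iff.1 hN), mul_zero, sum_const_zero, add_zero, ← ite_and, h_toNat]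
    rcases eq_or_ne s 0 with rfl | hs
    · have hN' : N ≠ 0 := by
        rintro rfl
        simp at hN
      simp [hN']
    · simp [hs]

theorem vertexOp_mem {F : ℕ → Submodule ℂ V}
    (h : ∀ l d, ∀ v ∈ F d, T (ε * (l + 1 : ℕ)) v ∈ F (d - (l + 1))) (j d : ℕ) :
    ∀ v ∈ F d, vertexOp k T ε η j v ∈ F (d - j) := by
  refine coeff_expSeries_mem (fun l d v hv => ?_) j d
  rw [coeff_vertexExponent, if_neg l.succ_ne_zero]
  exact Submodule.smul_mem _ _ (h l d v hv)

theorem vertexOp_apply_eq_zero {v : V} (h : ∀ n : ℕ, T (ε * (n + 1 : ℕ)) v = 0) {j : ℕ}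
    (hj : j ≠ 0) : vertexOp k T ε η j v = 0 := by
  -- `v` spans the bottom step of a filtration whose lower steps vanish.
  have h_mem : vertexOp k T ε η j v ∈ if 1 - j = 0 then ⊥ else Submodule.span ℂ {v} := by
    refine vertexOp_mem (F := fun d => if d = 0 then ⊥ else Submodule.span ℂ {v})
      (fun l d w hw => ?_) j 1 v (Submodule.mem_span_singleton_self v)
    have hw' : w ∈ Submodule.span ℂ {v} := by
      split_ifs at hw
      · exact (Submodule.mem_bot ℂ).1 hw ▸ zero_mem _
      · exact hw
    obtain ⟨a, rfl⟩ := Submodule.mem_span_singleton.1 hw'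
    rw [map_smul, h l, smul_zero]
    exact zero_mem _
  rwa [if_pos (by omega), Submodule.mem_bot] at h_mem

theorem isFormAdjoint_vertexOp {B : V →ₗ⋆[ℂ] V →ₗ[ℂ] ℂ} (hT : ∀ m n, Commute (T m) (T n))
    (h : ∀ n, IsFormAdjoint B (T n) (-T (-n))) (j : ℕ) :
    IsFormAdjoint B (vertexOp k T ε η j) (vertexOp k T (-ε) (-η) j) := by
  refine IsFormAdjoint.coeff_expSeries coeff_zero_vertexExponent (fun i j =>
    commute_coeff_vertexExponent (fun n => (commute_coeff_vertexExponent (hT n) i).symm) j)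
    (fun l => ?_) j
  rw [coeff_vertexExponent, coeff_vertexExponent]
  split_ifs
  · exact fun x y => by simp
  · convert (h (ε * l)).smul (-((ε : ℤ) * (2 * Complex.I * η / k))) using 1
    simp only [map_neg, map_mul, map_div₀, Complex.conj_I, Complex.conj_ofReal, map_ofNat,
      map_intCast, Units.val_neg, neg_mul, Int.cast_neg]
    rw [smul_neg, ← neg_smul]
    push_cast
    ring_nf

section Lie

variable {D : Module.End ℂ V} {m : ℤ}

theorem commute_vertexOp_of_nonneg
    (hD : ∀ n, ⁅D, T n⁆ = if m + n = 0 then (k / 2 * m : ℂ) • 1 else 0) (hm : 0 ≤ ε * m) (j : ℕ) :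
    Commute D (vertexOp k T ε η j) := by
  refine commute_coeff_expSeries coeff_zero_vertexExponent (fun l => ?_) j
  rw [coeff_vertexExponent]
  split_ifs with hl
  · exact Commute.zero_right _
  · refine Commute.smul_right (commute_iff_lie_eq.2 ?_) _
    rw [hD, if_neg]
    rcases Int.units_eq_one_or ε with rfl | rfl <;> simp at hm ⊢ <;> omega

theorem lie_vertexOp (hk : k ≠ 0)
    (hD : ∀ n, ⁅D, T n⁆ = if m + n = 0 then (k / 2 * m : ℂ) • 1 else 0) {p : ℕ} (hp : p ≠ 0)
    (hm : m = -(ε * p)) (j : ℕ) : ⁅D, vertexOp k T ε η j⁆ =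
      if p ≤ j then (Complex.I * η) • vertexOp k T ε η (j - p) else 0 := by
  refine lie_coeff_expSeries coeff_zero_vertexExponent hp (fun l => ?_) j
  have h_iff : m + ε * l = 0 ↔ l = p := by
    rcases Int.units_eq_one_or ε with rfl | rfl <;> simp [hm] <;> omega
  rw [coeff_vertexExponent]
  split_ifs with hl hlp hlp
  · exact absurd (hlp.symm.trans hl) hp
  · exact lie_zero D
  · have hε : ((ε : ℤ) : ℂ) * (ε : ℤ) = 1 := by
      rcases Int.units_eq_one_or ε with rfl | rfl <;> simp
    rw [lie_smul, hD, if_pos (h_iff.2 hlp), smul_smul, hm]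
    congr 1
    push_cast
    have hk' : (k : ℂ) ≠ 0 := Complex.ofReal_ne_zero.2 hk
    field_simp
    linear_combination (η : ℂ) * hε
  · rw [lie_smul, hD, if_neg (mt h_iff.1 hlp), smul_zero]

end Lie

end VertexOperators

section Dressing

open Finset

variable {V : Type*} [AddCommGroup V] [Module ℂ V] [TopologicalSpace V] [DiscreteTopology V]
  {k η : ℝ} {ε : ℤˣ} {T Q Q' R R' : ℤ → Module.End ℂ V} {e : ℕ → Module.End ℂ V}
  {D : Module.End ℂ V}

/-- The modes `Q'` are those of the product of the field with modes `Q` and the field with modes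
`eⱼ` in degree `εj`. -/
def IsDressing (e : ℕ → Module.End ℂ V) (ε : ℤˣ) (Q Q' : ℤ → Module.End ℂ V) : Prop :=
  ∀ m, HasSum (fun j : ℕ => e j * Q (m - ε * j)) (Q' m)

namespace IsDressing

theorem commute (h : IsDressing e ε Q Q') (he : ∀ j, Commute D (e j)) (hQ : ∀ n, Commute D (Q n))
    (n : ℤ) : Commute D (Q' n) :=
  commute_of_hasSum (h n) fun j => (he j).mul_right (hQ _)

theorem lie_of_commute {m : ℤ} {c : ℂ} (h : IsDressing e ε Q Q') (he : ∀ j, Commute D (e j))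
    (hQ : ∀ n, ⁅D, Q n⁆ = c • Q (m + n)) (n : ℤ) : ⁅D, Q' n⁆ = c • Q' (m + n) := by
  have h_term : ∀ j : ℕ, ⁅D, e j * Q (n - ε * j)⁆ = (c • 1) * (e j * Q (m + n - ε * j)) := by
    intro j
    rw [smul_one_mul, ← mul_smul_comm, add_sub_assoc, ← hQ, Ring.lie_def, Ring.lie_def, mul_sub,
      ← mul_assoc, (he j).eq, mul_assoc, mul_assoc]
  rw [← smul_one_mul c]
  exact (hasSum_end_lie_left D (h n)).unique
    (by simpa only [h_term] using hasSum_end_mul_left (h (m + n)) (c • 1))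

theorem lie_of_shift {m : ℤ} {c : ℂ} {p : ℕ} (h : IsDressing e ε Q Q') (hQ : ∀ n, Commute D (Q n))
    (he : ∀ j, ⁅D, e j⁆ = if p ≤ j then c • e (j - p) else 0) (hm : m = -(ε * p)) (n : ℤ) :
    ⁅D, Q' n⁆ = c • Q' (m + n) := by
  have h_term : ∀ j : ℕ, ⁅D, e j * Q (n - ε * j)⁆ = ⁅D, e j⁆ * Q (n - ε * j) := by
    intro j
    rw [Ring.lie_def, Ring.lie_def, sub_mul, mul_assoc (e j), ← (hQ _).eq]
    simp only [mul_assoc]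
  have h_shift : ∀ i : ℕ, ⁅D, e (i + p)⁆ * Q (n - ε * (i + p : ℕ)) =
      (c • 1) * (e i * Q (m + n - ε * i)) := by
    intro i
    rw [he, if_pos (Nat.le_add_left _ _), Nat.add_sub_cancel, smul_mul_assoc, smul_one_mul, hm]
    push_cast
    ring_nf
  have h_support : ∀ j ∉ Set.range (· + p), ⁅D, e j⁆ * Q (n - ε * j) = 0 := by
    intro j hj
    rw [he, if_neg fun hpj => hj ⟨j - p, Nat.sub_add_cancel hpj⟩, zero_mul]
  have h_left := hasSum_end_lie_left D (h n)
  simp only [h_term] at h_left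
  have h_right := hasSum_end_mul_left (h (m + n)) (c • 1)
  simp only [← h_shift] at h_right
  rw [← smul_one_mul c]
  exact h_left.unique ((Function.Injective.hasSum_iff (add_left_injective p) h_support).1 h_right)

theorem lie_vertexOp_of_neg {m : ℤ} (hk : k ≠ 0) (h : IsDressing (vertexOp k T ε η) ε Q Q')
    (hD : ∀ n, ⁅D, T n⁆ = if m + n = 0 then (k / 2 * m : ℂ) • 1 else 0)
    (hQ : ∀ n, Commute D (Q n)) (hm : ε * m < 0) (n : ℤ) :
    ⁅D, Q' n⁆ = (Complex.I * η) • Q' (m + n) := by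
  have hm' : m = -(ε * (m.natAbs : ℕ)) := by
    rcases Int.units_eq_one_or ε with rfl | rfl <;> simp [-Nat.cast_natAbs] at hm ⊢ <;> omega
  have hp : m.natAbs ≠ 0 := by
    rw [Int.natAbs_ne_zero]
    rintro rfl
    simp at hm
  exact h.lie_of_shift hQ (lie_vertexOp hk hD hp hm') hm' n

theorem lie_vertexOp_vertexOp_neg {Θ : ℤ → Module.End ℂ V} (hk : k ≠ 0)
    (hT : ∀ m n, Commute (T m) (T n)) (hTQ : ∀ m n, Commute (T m) (Q n))
    (hTR : ∀ m n, Commute (T m) (R n))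
    (hQR : ∀ m n, ⁅Q m, R n⁆ = Θ (m + n) + if m + n = 0 then (k * m : ℂ) • 1 else 0)
    (hQ : IsDressing (vertexOp k T ε η) ε Q Q') (hR : IsDressing (vertexOp k T ε (-η)) ε R R')
    (m n : ℤ) : ⁅Q' m, R' n⁆ =
      Θ (m + n) + (if 0 < ε * (m + n) then (2 * Complex.I * η) • T (m + n) else 0) +
        if m + n = 0 then (k * m : ℂ) • 1 else 0 := by
  have h_term : ∀ p : ℕ × ℕ, ⁅vertexOp k T ε η p.1 * Q (m - ε * p.1),
      vertexOp k T ε (-η) p.2 * R (n - ε * p.2)⁆ =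
      vertexOp k T ε η p.1 * vertexOp k T ε (-η) p.2 *
        (Θ (m + n - ε * (p.1 + p.2 : ℕ)) + if m + n - ε * (p.1 + p.2 : ℕ) = 0 then
          (k * (m - ε * p.1 : ℤ) : ℂ) • 1 else 0) := by
    intro p
    have h_index : m - ε * p.1 + (n - ε * p.2) = m + n - ε * (p.1 + p.2 : ℕ) := by
      push_cast
      ring
    rw [← h_index, ← hQR, Ring.lie_def, Ring.lie_def, mul_sub]
    have hQe := commute_vertexOp (k := k) (ε := ε) (η := -η)
      (fun l => (hTQ l (m - ε * p.1)).symm) p.2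
    have hRe := commute_vertexOp (k := k) (ε := ε) (η := η)
      (fun l => (hTR l (n - ε * p.2)).symm) p.1
    have hee := commute_vertexOp_vertexOp (k := k) (ε := ε) (η := η) hT ε (-η) p.1 p.2
    rw [hQe.mul_mul_mul_comm, hRe.mul_mul_mul_comm, hee.eq]
  have h_lie := hasSum_end_lie (hQ m) (hR n)
  simp only [h_term] at h_lie
  have h_sum := hasSum_antidiagonal h_lie
  have h_fiber : ∀ s, ∑ p ∈ antidiagonal s, vertexOp k T ε η p.1 * vertexOp k T ε (-η) p.2 *
      (Θ (m + n - ε * (p.1 + p.2 : ℕ)) + if m + n - ε * (p.1 + p.2 : ℕ) = 0 then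
        (k * (m - ε * p.1 : ℤ) : ℂ) • 1 else 0) = _ := fun s =>
    (sum_congr rfl fun p hp => by rw [mem_antidiagonal.1 hp]).trans
      (sum_vertexOp_mul_vertexOp_neg_mul hk hT m (m + n) s)
  simp only [h_fiber] at h_sum
  rw [h_sum.unique ((hasSum_ite_eq 0 _).add (hasSum_ite_eq _ _))]
  abel

theorem apply_eq_zero {m : ℤ} {v : V} (h : IsDressing e ε Q Q')
    (h_zero : ∀ j : ℕ, e j (Q (m - ε * j) v) = 0) : Q' m v = 0 :=
  (hasSum_end_iff.1 (h m) v).unique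
    (by simpa only [Module.End.mul_apply, h_zero] using hasSum_zero)

end IsDressing

/-- The modes `Q'` are those of the product of the field with modes `Q` and the full vertex
operator `exp(-(2iη/k) ∑_{n ≠ 0} Tₙ zⁿ / n)`. -/
def IsVertexDressing (k : ℝ) (T : ℤ → Module.End ℂ V) (η : ℝ) (Q Q' : ℤ → Module.End ℂ V) :
    Prop :=
  ∀ n, HasSum (fun p : ℕ × ℕ => vertexOp k T 1 η p.1 * vertexOp k T (-1) η p.2 *
    Q (n - p.1 + p.2)) (Q' n)

theorem exists_isVertexDressing (hT : ∀ m n, Commute (T m) (T n))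
    (hTQ : ∀ m n, Commute (T m) (Q n)) (hQ : ∀ v, ∀ᶠ n in Filter.atTop, Q n v = 0)
    (hv : ∀ v, ∀ᶠ j in Filter.atTop, vertexOp k T 1 η j v = 0) :
    ∃ Q', IsVertexDressing k T η Q Q' := by
  have h_comm : ∀ (p : ℕ × ℕ) n, vertexOp k T 1 η p.1 * vertexOp k T (-1) η p.2 * Q n =
      vertexOp k T (-1) η p.2 * Q n * vertexOp k T 1 η p.1 := by
    intro p n
    have h_left := commute_vertexOp_vertexOp (k := k) (ε := 1) (η := η) hT (-1) η p.1 p.2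
    have h_right := commute_vertexOp (k := k) (ε := 1) (η := η) (fun l => (hTQ l n).symm) p.1
    exact (h_left.mul_right h_right.symm |>.eq) ▸ (mul_assoc _ _ _)
  suffices h : ∀ n, Summable fun p : ℕ × ℕ => vertexOp k T 1 η p.1 * vertexOp k T (-1) η p.2 *
      Q (n - p.1 + p.2) from ⟨_, fun n => (h n).hasSum⟩
  refine fun n => summable_end_iff.2 fun v => summable_of_hasFiniteSupport ?_
  obtain ⟨N, hN⟩ := Filter.eventually_atTop.1 (hv v)
  choose M hM using fun j : ℕ => Filter.eventually_atTop.1 (hQ (vertexOp k T 1 η j v))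
  refine ((Set.finite_lt_nat N).biUnion fun j _ =>
    (Set.finite_lt_nat (M j - n + j).toNat).image (Prod.mk j)).subset fun ⟨j, i⟩ hp => ?_
  rw [Function.mem_support, h_comm, Module.End.mul_apply, Module.End.mul_apply] at hp
  refine Set.mem_biUnion (x := j) ?_ ⟨i, ?_, rfl⟩
  · by_contra hj
    exact hp (by rw [hN j (not_lt.1 hj), map_zero, map_zero])
  · by_contra hi
    have hi' : (M j - n + j).toNat ≤ i := not_lt.1 hi
    exact hp (by rw [hM j _ (by push_cast; omega), map_zero])

namespace IsVertexDressing

theorem exists_isDressing (h : IsVertexDressing k T η Q Q') :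
    ∃ P, IsDressing (vertexOp k T (-1) η) (-1) Q P ∧ IsDressing (vertexOp k T 1 η) 1 P Q' := by
  have h_summable : ∀ m : ℤ,
      Summable fun i : ℕ => vertexOp k T (-1) η i * Q (m - (-1 : ℤˣ) * i) := by
    refine fun m => summable_end_iff.2 fun v => summable_of_hasFiniteSupport ?_
    have h_finite := (hasSum_end_iff.1 (h m) v).summable.hasFiniteSupport_of_discreteTopology
    refine (Set.Finite.preimage (Prod.mk_right_injective (0 : ℕ)).injOn h_finite).subset
      fun i hi => ?_
    simpa [vertexOp_zero] using hi
  refine ⟨_, fun m => (h_summable m).hasSum, fun n => (h n).prod_fiberwise fun j => ?_⟩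
  have h_inner := hasSum_end_mul_left (h_summable (n - j)).hasSum (vertexOp k T 1 η j)
  simpa [mul_assoc] using h_inner

theorem commute (h : IsVertexDressing k T η Q Q') (hDT : ∀ n, Commute D (T n))
    (hDQ : ∀ n, Commute D (Q n)) (n : ℤ) : Commute D (Q' n) :=
  commute_of_hasSum (h n) fun p =>
    ((commute_vertexOp hDT p.1).mul_right (commute_vertexOp hDT p.2)).mul_right (hDQ _)

theorem commute_commute {η' : ℝ} (hQ : IsVertexDressing k T η Q Q')
    (hR : IsVertexDressing k T η' R R') (hT : ∀ m n, Commute (T m) (T n))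
    (hTQ : ∀ m n, Commute (T m) (Q n)) (hTR : ∀ m n, Commute (T m) (R n))
    (hQR : ∀ m n, Commute (Q m) (R n)) (m n : ℤ) : Commute (Q' m) (R' n) :=
  hR.commute (fun l => (hQ.commute (hT l) (hTQ l) m).symm)
    (fun l => (hQ.commute (fun i => (hTR i l).symm) (fun i => (hQR i l).symm) m).symm) n

theorem lie {m : ℤ} (h : IsVertexDressing k T η Q Q') (hk : k ≠ 0)
    (hD : ∀ n, ⁅D, T n⁆ = if m + n = 0 then (k / 2 * m : ℂ) • 1 else 0)
    (hQ : ∀ n, ⁅D, Q n⁆ = if m = 0 then (Complex.I * η) • Q n else 0) (n : ℤ) :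
    ⁅D, Q' n⁆ = (Complex.I * η) • Q' (m + n) := by
  obtain ⟨P, hP, hQ'⟩ := h.exists_isDressing
  rcases lt_trichotomy m 0 with hm | rfl | hm
  · have hDQ : ∀ n, Commute D (Q n) := fun n =>
      commute_iff_lie_eq.2 (by rw [hQ, if_neg hm.ne])
    exact hQ'.lie_vertexOp_of_neg hk hD
      (hP.commute (commute_vertexOp_of_nonneg hD (by simpa using hm.le)) hDQ) (by simpa using hm) n
  · refine hQ'.lie_of_commute (commute_vertexOp_of_nonneg hD (by simp))
      (hP.lie_of_commute (commute_vertexOp_of_nonneg hD (by simp)) fun n => ?_) n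
    rw [hQ, if_pos rfl, zero_add]
  · have hDQ : ∀ n, Commute D (Q n) := fun n =>
      commute_iff_lie_eq.2 (by rw [hQ, if_neg hm.ne'])
    exact hQ'.lie_of_commute (commute_vertexOp_of_nonneg hD (by simpa using hm.le))
      (hP.lie_vertexOp_of_neg hk hD hDQ (by simpa using hm)) n

theorem lie_neg (hk : k ≠ 0) (hT : ∀ m n, Commute (T m) (T n))
    (hTQ : ∀ m n, Commute (T m) (Q n)) (hTR : ∀ m n, Commute (T m) (R n))
    (hQR : ∀ m n, ⁅Q m, R n⁆ =
      if m + n = 0 then (2 * Complex.I * η) • T 0 + (k * m : ℂ) • 1 else 0)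
    (hQ : IsVertexDressing k T η Q Q') (hR : IsVertexDressing k T (-η) R R') (m n : ℤ) :
    ⁅Q' m, R' n⁆ =
      (2 * Complex.I * η) • T (m + n) + if m + n = 0 then (k * m : ℂ) • 1 else 0 := by
  obtain ⟨P, hP, hQ'⟩ := hQ.exists_isDressing
  obtain ⟨S, hS, hR'⟩ := hR.exists_isDressing
  have h_bare : ∀ m n, ⁅Q m, R n⁆ = (if m + n = 0 then (2 * Complex.I * η) • T (m + n) else 0) +
      if m + n = 0 then (k * m : ℂ) • 1 else 0 := by
    intro m n
    rw [hQR]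
    split_ifs with h
    · rw [h]
    · rw [add_zero]
  have h_neg := IsDressing.lie_vertexOp_vertexOp_neg hk hT hTQ hTR
    (Θ := fun s => if s = 0 then (2 * Complex.I * η) • T s else 0) h_bare hP hS
  have hTP : ∀ m n, Commute (T m) (P n) := fun m => hP.commute (commute_vertexOp (hT m)) (hTQ m)
  have hTS : ∀ m n, Commute (T m) (S n) := fun m => hS.commute (commute_vertexOp (hT m)) (hTR m)
  rw [IsDressing.lie_vertexOp_vertexOp_neg hk hT hTP hTS
    (Θ := fun s => (if s = 0 then (2 * Complex.I * η) • T s else 0) +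
      if 0 < (-1 : ℤˣ) * s then (2 * Complex.I * η) • T s else 0) h_neg hQ' hR']
  congr 1
  generalize m + n = s
  rcases lt_trichotomy s 0 with h | h | h
  · simp [h, h.ne, h.not_gt]
  · simp [h]
  · simp [h, h.ne', h.not_gt]

theorem apply_eq_zero {n : ℤ} {v : V} (h : IsVertexDressing k T η Q Q')
    (hT : ∀ m n, Commute (T m) (T n)) (hTQ : ∀ m n, Commute (T m) (Q n))
    (hv : ∀ l : ℕ, T (l + 1 : ℕ) v = 0) (hQ : ∀ m, n ≤ m → Q m v = 0) : Q' n v = 0 := by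
  obtain ⟨P, hP, hQ'⟩ := h.exists_isDressing
  refine hQ'.apply_eq_zero fun j => ?_
  have h_comm := hP.commute (D := vertexOp k T 1 η j)
    (commute_vertexOp_vertexOp hT (-1) η j)
    (fun l => (commute_vertexOp (fun i => (hTQ i l).symm) j).symm)
  rw [← Module.End.mul_apply, (h_comm _).eq, Module.End.mul_apply]
  rcases eq_or_ne j 0 with rfl | hj
  · rw [vertexOp_zero, Module.End.one_apply]
    refine hP.apply_eq_zero fun i => ?_
    rw [hQ _ (by simp), map_zero]
  · rw [vertexOp_apply_eq_zero (fun l => by simpa using hv l) hj, map_zero]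

theorem isFormAdjoint {B : V →ₗ⋆[ℂ] V →ₗ[ℂ] ℂ} (hQ : IsVertexDressing k T η Q Q')
    (hR : IsVertexDressing k T (-η) R R') (hT : ∀ m n, Commute (T m) (T n))
    (hTR : ∀ m n, Commute (T m) (R n)) (hBT : ∀ n, IsFormAdjoint B (T n) (-T (-n)))
    (hQR : ∀ n, IsFormAdjoint B (Q n) (-R (-n))) (n : ℤ) :
    IsFormAdjoint B (Q' n) (-R' (-n)) := by
  have h_swap := (Equiv.hasSum_iff (f := fun p : ℕ × ℕ => vertexOp k T 1 (-η) p.1 *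
    vertexOp k T (-1) (-η) p.2 * R (-n - p.1 + p.2)) (Equiv.prodComm ℕ ℕ)).2 (hR (-n))
  refine IsFormAdjoint.of_hasSum (hQ n) h_swap.neg fun p => ?_
  have h_term := ((isFormAdjoint_vertexOp (ε := 1) (η := η) (k := k) hT hBT p.1).mul
    (isFormAdjoint_vertexOp (ε := -1) (η := η) (k := k) hT hBT p.2)).mul (hQR (n - p.1 + p.2))
  have h_comm := ((commute_vertexOp (k := k) (ε := 1) (η := -η)
    (fun l => (hTR l (-(n - p.1 + p.2))).symm) p.2).mul_right (commute_vertexOp (k := k)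
      (ε := -1) (η := -η) (fun l => (hTR l (-(n - p.1 + p.2))).symm) p.1)).neg_left
  rw [neg_neg, h_comm.eq, mul_neg,
    show -(n - p.1 + p.2) = -n - p.2 + (p.1 : ℤ) by ring] at h_term
  exact h_term

end IsVertexDressing

end Dressing

section FockSpace

open MvPolynomial

variable {σ : Type*} (lam : σ → ℝ)

/-- The squared norm of the monomial with exponents `m` in the Fock space of a family of
oscillators, when the oscillator `i` has squared norm `lam i`. -/
noncomputable def fockWeight (m : σ →₀ ℕ) : ℝ := m.prod fun i e => (e.factorial : ℝ) * lam i ^ e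

theorem fockWeight_add_single (m : σ →₀ ℕ) (i : σ) :
    fockWeight lam (m + Finsupp.single i 1) = fockWeight lam m * ((m i + 1) * lam i) := by
  classical
  have h_split (e : ℕ) : fockWeight lam (m.erase i + Finsupp.single i e) =
      fockWeight lam (m.erase i) * (e.factorial * lam i ^ e) := by
    rw [fockWeight, Finsupp.prod_add_index_of_disjoint, Finsupp.prod_single_index (by simp),
      fockWeight]
    exact Finset.disjoint_left.2 fun j hj hj' => by
      have := Finsupp.support_single_subset hj'
      simp_all
  have h_add : m + Finsupp.single i 1 = m.erase i + Finsupp.single i (m i + 1) := by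
    rw [Finsupp.single_add, ← add_assoc, Finsupp.erase_add_single]
  rw [h_add, h_split, ← congrArg (fockWeight lam) (Finsupp.erase_add_single i m), h_split,
    Nat.factorial_succ, pow_succ]
  push_cast
  ring

theorem fockWeight_nonneg (m : σ →₀ ℕ) (h : ∀ i, m i ≠ 0 → 0 ≤ lam i) : 0 ≤ fockWeight lam m :=
  Finset.prod_nonneg fun i hi =>
    mul_nonneg (Nat.cast_nonneg _) (pow_nonneg (h i (Finsupp.mem_support_iff.1 hi)) _)

/-- The Hermitian form on the Fock space for which distinct monomials are orthogonal. -/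
noncomputable def fockForm : MvPolynomial σ ℂ →ₗ⋆[ℂ] MvPolynomial σ ℂ →ₗ[ℂ] ℂ :=
  have h_finite (f g : MvPolynomial σ ℂ) : (Function.support fun m =>
      (fockWeight lam m : ℂ) * starRingEnd ℂ (coeff m f) * coeff m g).Finite :=
    g.support.finite_toSet.subset fun m hm => mem_support_iff.2 (right_ne_zero_of_mul hm)
  LinearMap.mk₂'ₛₗ (starRingEnd ℂ) (RingHom.id ℂ)
    (fun f g => ∑ᶠ m, (fockWeight lam m : ℂ) * starRingEnd ℂ (coeff m f) * coeff m g)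
    (fun f f' g => by
      rw [← finsum_add_distrib (h_finite f g) (h_finite f' g)]
      simp only [coeff_add, map_add, mul_add, add_mul])
    (fun c f g => by
      rw [smul_eq_mul, mul_finsum]
      simp only [coeff_smul, smul_eq_mul, map_mul]
      exact finsum_congr fun m => by ring)
    (fun f g g' => by
      rw [← finsum_add_distrib (h_finite f g) (h_finite f g')]
      simp only [coeff_add, mul_add])
    (fun c f g => by
      rw [smul_eq_mul, mul_finsum]
      simp only [coeff_smul, smul_eq_mul, RingHom.id_apply]
      exact finsum_congr fun m => by ring)

theorem fockForm_apply (f g : MvPolynomial σ ℂ) : fockForm lam f g =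
    ∑ᶠ m, (fockWeight lam m : ℂ) * starRingEnd ℂ (coeff m f) * coeff m g := rfl

theorem fockForm_monomial (m : σ →₀ ℕ) (c : ℂ) (g : MvPolynomial σ ℂ) :
    fockForm lam (monomial m c) g = fockWeight lam m * starRingEnd ℂ c * coeff m g := by
  classical
  rw [fockForm_apply, finsum_eq_single _ m, coeff_monomial, if_pos rfl]
  intro m' hm
  rw [coeff_monomial, if_neg hm.symm, map_zero, mul_zero, zero_mul]

theorem fockForm_one : fockForm lam 1 1 = 1 := by
  have h_monomial := fockForm_monomial lam 0 1 1
  rw [monomial_zero', C_1] at h_monomial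
  simpa [fockWeight] using h_monomial

theorem fockForm_self (f : MvPolynomial σ ℂ) : fockForm lam f f =
    ∑ m ∈ f.support, (fockWeight lam m : ℂ) * Complex.normSq (coeff m f) := by
  simp only [Complex.normSq_eq_conj_mul_self, ← mul_assoc]
  exact finsum_eq_finsetSum_of_support_subset _ fun m hm =>
    mem_support_iff.2 (right_ne_zero_of_mul hm)

theorem fockForm_self_nonneg {f : MvPolynomial σ ℂ}
    (h : ∀ m ∈ f.support, ∀ i, m i ≠ 0 → 0 ≤ lam i) : 0 ≤ (fockForm lam f f).re := by
  rw [fockForm_self, Complex.re_sum]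
  refine Finset.sum_nonneg fun m hm => ?_
  rw [← Complex.ofReal_mul, Complex.ofReal_re]
  exact mul_nonneg (fockWeight_nonneg lam m (h m hm)) (Complex.normSq_nonneg _)

theorem fockForm_hermitian (f g : MvPolynomial σ ℂ) :
    starRingEnd ℂ (fockForm lam f g) = fockForm lam g f := by
  have h_left : fockForm lam f g = ∑ m ∈ f.support,
      (fockWeight lam m : ℂ) * starRingEnd ℂ (coeff m f) * coeff m g :=
    finsum_eq_finsetSum_of_support_subset _ fun m hm => mem_support_iff.2 fun h => hm (by simp [h])
  have h_right : fockForm lam g f = ∑ m ∈ f.support,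
      (fockWeight lam m : ℂ) * starRingEnd ℂ (coeff m g) * coeff m f :=
    finsum_eq_finsetSum_of_support_subset _ fun m hm =>
      mem_support_iff.2 (right_ne_zero_of_mul hm)
  rw [h_left, h_right, map_sum]
  refine Finset.sum_congr rfl fun m _ => ?_
  rw [map_mul, map_mul, Complex.conj_ofReal, Complex.conj_conj]
  ring

theorem isFormAdjoint_fockForm_symm {a a' : Module.End ℂ (MvPolynomial σ ℂ)}
    (h : IsFormAdjoint (fockForm lam) a a') : IsFormAdjoint (fockForm lam) a' a := fun x y => by
  rw [← fockForm_hermitian, ← h, fockForm_hermitian]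

/-- The creation operator of the oscillator `i` (multiplication by the variable) if `b` holds, and
minus its adjoint, a multiple of the annihilation operator, otherwise. -/
noncomputable def ladder (b : Bool) (i : σ) : Module.End ℂ (MvPolynomial σ ℂ) :=
  if b then LinearMap.mulLeft ℂ (MvPolynomial.X i)
  else -((lam i : ℂ) • (pderiv (R := ℂ) i).toLinearMap)

theorem ladder_true_apply (i : σ) (f : MvPolynomial σ ℂ) :
    ladder lam true i f = MvPolynomial.X i * f := rfl

theorem ladder_false_apply (i : σ) (f : MvPolynomial σ ℂ) :
    ladder lam false i f = -((lam i : ℂ) • pderiv i f) := rfl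

theorem ladder_false_one (i : σ) : ladder lam false i 1 = 0 := by
  rw [ladder_false_apply, pderiv_one, smul_zero, neg_zero]

theorem fockForm_X_mul (i : σ) (f g : MvPolynomial σ ℂ) :
    fockForm lam (MvPolynomial.X i * f) g = fockForm lam f ((lam i : ℂ) • pderiv i g) := by
  induction f using MvPolynomial.induction_on' with
  | monomial m c =>
    rw [MvPolynomial.X, monomial_mul, one_mul, add_comm, fockForm_monomial, fockForm_monomial,
      fockWeight_add_single, coeff_smul, coeff_pderiv, smul_eq_mul]
    push_cast
    ring
  | add p q hp hq =>
    rw [mul_add, map_add, map_add, LinearMap.add_apply, LinearMap.add_apply, hp, hq]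

theorem isFormAdjoint_ladder (b : Bool) (i : σ) :
    IsFormAdjoint (fockForm lam) (ladder lam b i) (-ladder lam (!b) i) := by
  have h_true : IsFormAdjoint (fockForm lam) (ladder lam true i) (-ladder lam false i) :=
    fun x y => by
      rw [ladder_true_apply, LinearMap.neg_apply, ladder_false_apply, neg_neg, fockForm_X_mul]
  cases b
  · intro x y
    rw [LinearMap.neg_apply, map_neg, Bool.not_false, ← isFormAdjoint_fockForm_symm lam h_true,
      LinearMap.neg_apply, map_neg, LinearMap.neg_apply, neg_neg]
  · exact h_true

theorem lie_ladder [DecidableEq σ] (b b' : Bool) (i j : σ) :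
    ⁅ladder lam b i, ladder lam b' j⁆ =
      if i = j ∧ b ≠ b' then (if b then (lam i : ℂ) else -lam i) • 1 else 0 := by
  have h_pderiv : ∀ f : MvPolynomial σ ℂ, pderiv i (pderiv j f) = pderiv j (pderiv i f) := by
    have h_lie : ⁅pderiv (R := ℂ) i, pderiv (R := ℂ) j⁆ = 0 := by
      refine MvPolynomial.derivation_ext fun l => ?_
      simp [Derivation.commutator_apply, pderiv_X, Pi.single_apply, apply_ite]
    exact fun f => sub_eq_zero.1 (DFunLike.congr_fun h_lie f)
  refine LinearMap.ext fun f => ?_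
  cases b <;> cases b' <;> simp only [Ring.lie_def, LinearMap.sub_apply, Module.End.mul_apply,
    ladder_true_apply, ladder_false_apply]
  · simp [h_pderiv, smul_comm (lam i : ℂ)]
  · rcases eq_or_ne i j with rfl | h
    · simp
    · simp [h, pderiv_X_of_ne h.symm]
  · rcases eq_or_ne i j with rfl | h
    · simp
    · simp [h, pderiv_X_of_ne h]
  · simp [mul_left_comm]

theorem commute_ladder {i j : σ} {b b' : Bool} (h : i = j → b = b') :
    Commute (ladder lam b i) (ladder lam b' j) := by
  classical
  rw [commute_iff_lie_eq, lie_ladder, if_neg fun h' => h'.2 (h h'.1)]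

theorem eventually_ladder_false_eq_zero {ι : ℤ → σ} (hι : Function.Injective ι)
    (f : MvPolynomial σ ℂ) : ∀ᶠ n in Filter.atTop, ladder lam false (ι n) f = 0 := by
  classical
  obtain ⟨N, hN⟩ := (f.vars.finite_toSet.preimage hι.injOn).bddAbove
  filter_upwards [Filter.eventually_gt_atTop N] with n hn
  rw [ladder_false_apply, pderiv_eq_zero_of_notMem_vars fun h => hn.not_ge (hN h), smul_zero,
    neg_zero]

theorem eq_zero_of_mem_support_of_ladder_false_eq_zero {f : MvPolynomial σ ℂ} {i : σ}
    (hi : lam i ≠ 0) (hf : ladder lam false i f = 0) {m : σ →₀ ℕ} (hm : m ∈ f.support) :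
    m i = 0 := by
  by_contra h
  have h_pderiv : pderiv i f = 0 := by
    rw [ladder_false_apply, neg_eq_zero, smul_eq_zero] at hf
    exact hf.resolve_left (Complex.ofReal_ne_zero.2 hi)
  have h_coeff := coeff_pderiv (i := i) f (m - Finsupp.single i 1)
  rw [h_pderiv, coeff_zero, tsub_add_cancel_of_le
    (Finsupp.single_le_iff.2 (Nat.one_le_iff_ne_zero.2 h))] at h_coeff
  exact mul_ne_zero (mem_support_iff.1 hm) (Nat.cast_add_one_ne_zero _) h_coeff.symm

/-- The operator measuring the total charge, where the oscillator `i` has charge `q i`. -/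
noncomputable def chargeOp (q : σ → ℝ) : Module.End ℂ (MvPolynomial σ ℂ) :=
  (mkDerivation ℂ fun i => (q i : ℂ) • MvPolynomial.X i).toLinearMap

theorem chargeOp_monomial (q : σ → ℝ) (m : σ →₀ ℕ) (c : ℂ) :
    chargeOp q (monomial m c) = ((Finsupp.weight q m : ℝ) : ℂ) • monomial m c := by
  rw [chargeOp, Derivation.coeFn_coe, mkDerivation_monomial, Finsupp.weight_apply, Finsupp.sum,
    Finsupp.sum, Finset.smul_sum, Complex.ofReal_sum, Finset.sum_smul]
  refine Finset.sum_congr rfl fun i hi => ?_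
  have h_le : Finsupp.single i 1 ≤ m :=
    Finsupp.single_le_iff.2 (Nat.one_le_iff_ne_zero.2 (Finsupp.mem_support_iff.1 hi))
  rw [smul_eq_mul, mul_smul_comm, MvPolynomial.X, monomial_mul, tsub_add_cancel_of_le h_le,
    smul_monomial, smul_monomial, smul_monomial]
  congr 1
  simp
  ring

theorem isFormAdjoint_chargeOp (q : σ → ℝ) :
    IsFormAdjoint (fockForm lam) (chargeOp q) (chargeOp q) := by
  classical
  intro f g
  induction f using MvPolynomial.induction_on' with
  | add p p' hp hp' => simp only [map_add, LinearMap.add_apply, hp, hp']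
  | monomial m c =>
    induction g using MvPolynomial.induction_on' with
    | add p p' hp hp' => simp only [map_add, hp, hp']
    | monomial m' c' =>
      simp only [chargeOp_monomial, map_smulₛₗ, LinearMap.smul_apply, fockForm_monomial,
        coeff_monomial, Complex.conj_ofReal, RingHom.id_apply]
      split_ifs with h
      · rw [h]
      · simp only [mul_zero, smul_zero]

theorem lie_chargeOp_ladder (q : σ → ℝ) (b : Bool) (i : σ) :
    ⁅chargeOp q, ladder lam b i⁆ = (if b then (q i : ℂ) else -q i) • ladder lam b i := by
  have h_X : ∀ f, chargeOp q (MvPolynomial.X i * f) =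
      (q i : ℂ) • (MvPolynomial.X i * f) + MvPolynomial.X i * chargeOp q f := fun f => by
    rw [chargeOp, Derivation.coeFn_coe, Derivation.leibniz, mkDerivation_X, smul_eq_mul,
      smul_eq_mul, mul_smul_comm, mul_comm f, add_comm]
  have h_pderiv : ∀ f, chargeOp q (pderiv i f) =
      -(q i : ℂ) • pderiv i f + pderiv i (chargeOp q f) := by
    have h_lie : ⁅mkDerivation ℂ fun j => (q j : ℂ) • (MvPolynomial.X j : MvPolynomial σ ℂ),
        pderiv (R := ℂ) i⁆ = (-q i : ℂ) • pderiv i := by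
      classical
      refine MvPolynomial.derivation_ext fun l => ?_
      rcases eq_or_ne l i with rfl | h
      · simp [Derivation.commutator_apply]
      · simp [Derivation.commutator_apply, pderiv_X_of_ne h]
    exact fun f => sub_eq_iff_eq_add.1 (DFunLike.congr_fun h_lie f)
  refine LinearMap.ext fun f => ?_
  cases b
  · simp only [Ring.lie_def, LinearMap.sub_apply, Module.End.mul_apply, ladder_false_apply,
      map_neg, map_smul, h_pderiv, LinearMap.smul_apply, Bool.false_eq_true, if_false]
    module
  · simp only [Ring.lie_def, LinearMap.sub_apply, Module.End.mul_apply, ladder_true_apply, h_X,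
      add_sub_cancel_right, LinearMap.smul_apply, if_true]

end FockSpace

section EnergyFiltration

open MvPolynomial

variable {σ : Type*} {w : σ → ℕ}

/-- The polynomials all of whose monomials have weight less than `d`. -/
noncomputable def weightLT (w : σ → ℕ) (d : ℕ) : Submodule ℂ (MvPolynomial σ ℂ) :=
  restrictSupport ℂ {m | Finsupp.weight w m < d}

theorem weightLT_zero : weightLT w 0 = ⊥ := by
  simp [weightLT, restrictSupport_eq_span]

theorem exists_mem_weightLT (w : σ → ℕ) (f : MvPolynomial σ ℂ) : ∃ d, f ∈ weightLT w d :=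
  ⟨f.support.sup (Finsupp.weight w) + 1, (mem_restrictSupport_iff ℂ).2 fun _ hm =>
    Nat.lt_succ_of_le (Finset.le_sup hm)⟩

theorem ladder_false_mem_weightLT (lam : σ → ℝ) (i : σ) {d : ℕ} {f : MvPolynomial σ ℂ}
    (hf : f ∈ weightLT w d) : ladder lam false i f ∈ weightLT w (d - w i) := by
  rw [ladder_false_apply]
  refine neg_mem (Submodule.smul_mem _ _ ((mem_restrictSupport_iff ℂ).2 fun m hm => ?_))
  rw [Finset.mem_coe, mem_support_iff, coeff_pderiv] at hm
  have h_lt : Finsupp.weight w (m + Finsupp.single i 1) < d :=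
    (mem_restrictSupport_iff ℂ).1 hf (mem_support_iff.2 (left_ne_zero_of_mul hm))
  rw [map_add, Finsupp.weight_single, one_smul] at h_lt
  exact Nat.lt_sub_of_add_lt h_lt

end EnergyFiltration

section FreeBoson

variable {σ : Type*} {lam : σ → ℝ} {ι ι' : ℕ → σ} {κ : ℝ}
  {z z' : Module.End ℂ (MvPolynomial σ ℂ)}

/-- The modes of a free boson with zero mode `z`: the mode `n ≠ 0` annihilates (`n > 0`) or
creates (`n < 0`) the oscillator `ι |n|`. -/
noncomputable def bosonMode (lam : σ → ℝ) (ι : ℕ → σ) (z : Module.End ℂ (MvPolynomial σ ℂ))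
    (n : ℤ) : Module.End ℂ (MvPolynomial σ ℂ) :=
  if n = 0 then z else ladder lam (decide (n < 0)) (ι n.natAbs)

theorem bosonMode_zero : bosonMode lam ι z 0 = z := if_pos rfl

theorem bosonMode_of_pos {n : ℤ} (hn : 0 < n) :
    bosonMode lam ι z n = ladder lam false (ι n.natAbs) := by
  rw [bosonMode, if_neg hn.ne', decide_eq_false hn.not_gt]

theorem bosonMode_apply_one {n : ℤ} (hn : 0 < n) : bosonMode lam ι z n 1 = 0 := by
  rw [bosonMode_of_pos hn, ladder_false_one]

theorem commute_bosonMode {D : Module.End ℂ (MvPolynomial σ ℂ)} (hz : Commute D z)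
    (hD : ∀ b j, Commute D (ladder lam b (ι j))) (n : ℤ) : Commute D (bosonMode lam ι z n) := by
  unfold bosonMode
  split_ifs
  · exact hz
  · exact hD _ _

theorem commute_bosonMode_bosonMode (hι : ∀ i j, ι i ≠ ι' j) (hz : Commute z z')
    (h : ∀ b j, Commute z (ladder lam b (ι' j))) (h' : ∀ b j, Commute z' (ladder lam b (ι j)))
    (m n : ℤ) : Commute (bosonMode lam ι z m) (bosonMode lam ι' z' n) :=
  commute_bosonMode (commute_bosonMode hz.symm h' m).symm
    (fun b j => (commute_bosonMode (h b j).symm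
      (fun _ i => (commute_ladder lam fun hij => (hι i j hij).elim).symm) m).symm) n

theorem lie_bosonMode (hι : Function.Injective ι) (hκ : ∀ n, lam (ι n) = -κ * n)
    (hz : ∀ b j, Commute z (ladder lam b (ι j))) (m n : ℤ) :
    ⁅bosonMode lam ι z m, bosonMode lam ι z n⁆ = if m + n = 0 then (κ * m : ℂ) • 1 else 0 := by
  classical
  rcases eq_or_ne m 0 with rfl | hm
  · rw [bosonMode_zero, (commute_bosonMode (Commute.refl z) hz n).lie_eq]
    simp
  rcases eq_or_ne n 0 with rfl | hn
  · rw [bosonMode_zero, (commute_bosonMode (Commute.refl z) hz m).symm.lie_eq]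
    simp [hm]
  rw [bosonMode, bosonMode, if_neg hm, if_neg hn, lie_ladder, hι.eq_iff, hκ]
  have h_iff : m.natAbs = n.natAbs ∧ decide (m < 0) ≠ decide (n < 0) ↔ m + n = 0 := by
    rw [Ne, decide_eq_decide]
    omega
  simp only [h_iff]
  congr 2
  rcases hm.lt_or_gt with h | h
  · rw [if_pos (decide_eq_true h), Nat.cast_natAbs, abs_of_neg h]
    push_cast
    ring
  · rw [if_neg (by simpa using h.le), Nat.cast_natAbs, abs_of_pos h]
    push_cast
    ring

theorem isFormAdjoint_bosonMode (hz : IsFormAdjoint (fockForm lam) z (-z)) (n : ℤ) :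
    IsFormAdjoint (fockForm lam) (bosonMode lam ι z n) (-bosonMode lam ι z (-n)) := by
  rcases eq_or_ne n 0 with rfl | hn
  · rwa [neg_zero, bosonMode_zero]
  · have h_not : decide (-n < 0) = !decide (n < 0) := by
      rw [← decide_not, decide_eq_decide]
      omega
    rw [bosonMode, bosonMode, if_neg hn, if_neg (neg_ne_zero.2 hn), Int.natAbs_neg, h_not]
    exact isFormAdjoint_ladder lam _ _

end FreeBoson

section ModeRelations

variable {A : Type*} [Ring A] [Algebra ℂ A] {k b : ℝ} {φ : Mode → A}

/-- The commutation relations of the affine Nappi–Witten algebra, for a family of elements of an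
associative algebra. -/
structure ModeRelations (k b : ℝ) (φ : Mode → A) : Prop where
  Jp_Jm : ∀ m n, ⁅φ (.Jp m), φ (.Jm n)⁆ =
    (2 * Complex.I) • φ (.T (m + n)) + if m + n = 0 then (k * m : ℂ) • 1 else 0
  J_Jp : ∀ m n, ⁅φ (.J m), φ (.Jp n)⁆ = Complex.I • φ (.Jp (m + n))
  J_Jm : ∀ m n, ⁅φ (.J m), φ (.Jm n)⁆ = -(Complex.I • φ (.Jm (m + n)))
  J_T : ∀ m n, ⁅φ (.J m), φ (.T n)⁆ = if m + n = 0 then (k / 2 * m : ℂ) • 1 else 0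
  J_J : ∀ m n, ⁅φ (.J m), φ (.J n)⁆ = if m + n = 0 then (k * b / 2 * m : ℂ) • 1 else 0
  Jp_Jp : ∀ m n, Commute (φ (.Jp m)) (φ (.Jp n))
  Jm_Jm : ∀ m n, Commute (φ (.Jm m)) (φ (.Jm n))
  T_Jp : ∀ m n, Commute (φ (.T m)) (φ (.Jp n))
  T_Jm : ∀ m n, Commute (φ (.T m)) (φ (.Jm n))
  T_T : ∀ m n, Commute (φ (.T m)) (φ (.T n))

theorem algHom_central (f : FreeModes →ₐ[ℂ] A) (c : ℝ) (m n : ℤ) :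
    f (central c m n) = if m + n = 0 then (c : ℂ) • 1 else 0 := by
  unfold central
  split_ifs
  · rw [AlgHom.commutes, Algebra.algebraMap_eq_smul_one]
  · exact map_zero f

theorem modeRelations_mode (k b : ℝ) : ModeRelations k b (mode k b) := by
  have h_rel : ∀ {x y}, CommRel k b x y → RingQuot.mkAlgHom ℂ (CommRel k b) x =
      RingQuot.mkAlgHom ℂ (CommRel k b) y := fun h => RingQuot.mkAlgHom_rel ℂ h
  constructor <;> intro m n <;> simp only [commute_iff_lie_eq, Ring.lie_def]
  · simpa [mode, algHom_central] using h_rel (.Jp_Jm m n)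
  · simpa [mode] using h_rel (.J_Jp m n)
  · simpa [mode] using h_rel (.J_Jm m n)
  · simpa [mode, algHom_central] using h_rel (.J_T m n)
  · simpa [mode, algHom_central] using h_rel (.J_J m n)
  · simpa [mode] using h_rel (.Jp_Jp m n)
  · simpa [mode] using h_rel (.Jm_Jm m n)
  · simpa [mode] using h_rel (.T_Jp m n)
  · simpa [mode] using h_rel (.T_Jm m n)
  · simpa [mode] using h_rel (.T_T m n)

namespace ModeRelations

theorem freeAlgebra_lift_eq (h : ModeRelations k b φ) ⦃x y : FreeModes⦄ (hxy : CommRel k b x y) :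
    FreeAlgebra.lift ℂ φ x = FreeAlgebra.lift ℂ φ y := by
  cases hxy with
  | Jp_Jm m n => simpa [algHom_central, Ring.lie_def] using h.Jp_Jm m n
  | J_Jp m n => simpa [Ring.lie_def] using h.J_Jp m n
  | J_Jm m n => simpa [Ring.lie_def] using h.J_Jm m n
  | J_T m n => simpa [algHom_central, Ring.lie_def] using h.J_T m n
  | J_J m n => simpa [algHom_central, Ring.lie_def] using h.J_J m n
  | Jp_Jp m n => simpa [Ring.lie_def] using (h.Jp_Jp m n).lie_eq
  | Jm_Jm m n => simpa [Ring.lie_def] using (h.Jm_Jm m n).lie_eq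
  | T_Jp m n => simpa [Ring.lie_def] using (h.T_Jp m n).lie_eq
  | T_Jm m n => simpa [Ring.lie_def] using (h.T_Jm m n).lie_eq
  | T_T m n => simpa [Ring.lie_def] using (h.T_T m n).lie_eq

/-- The homomorphism from the enveloping algebra determined by the images of the modes. -/
noncomputable def lift (h : ModeRelations k b φ) : Env k b →ₐ[ℂ] A :=
  RingQuot.liftAlgHom ℂ ⟨FreeAlgebra.lift ℂ φ, h.freeAlgebra_lift_eq⟩

theorem lift_mode (h : ModeRelations k b φ) (g : Mode) : h.lift (mode k b g) = φ g := by
  rw [lift, mode, RingQuot.liftAlgHom_mkAlgHom_apply, FreeAlgebra.lift_ι_apply]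

end ModeRelations

/-- The automorphism of the affine algebra exchanging `J⁺` with `J⁻` and reversing the signs of `J`
and `T`, applied to a family of modes. It relates the highest and the lowest weight series. -/
def flipModes (φ : Mode → A) : Mode → A
  | .Jp n => φ (.Jm n)
  | .Jm n => φ (.Jp n)
  | .J n => -φ (.J n)
  | .T n => -φ (.T n)

theorem ModeRelations.flip (h : ModeRelations k b φ) : ModeRelations k b (flipModes φ) where
  Jp_Jm m n := by
    rw [flipModes, flipModes, flipModes, ← lie_skew, h.Jp_Jm, add_comm n m, neg_add, smul_neg]
    congr 1
    split_ifs with hmn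
    · rw [← neg_smul, show n = -m by omega]
      push_cast
      ring_nf
    · rw [neg_zero]
  J_Jp m n := by rw [flipModes, flipModes, flipModes, neg_lie, h.J_Jm, neg_neg]
  J_Jm m n := by rw [flipModes, flipModes, flipModes, neg_lie, h.J_Jp]
  J_T m n := by rw [flipModes, flipModes, neg_lie, lie_neg, neg_neg, h.J_T]
  J_J m n := by rw [flipModes, flipModes, neg_lie, lie_neg, neg_neg, h.J_J]
  Jp_Jp := h.Jm_Jm
  Jm_Jm := h.Jp_Jp
  T_Jp m n := (h.T_Jm m n).neg_left
  T_Jm m n := (h.T_Jp m n).neg_left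
  T_T m n := (h.T_T m n).neg_left.neg_right

/-- The span of the identity and the modes: the first step of the filtration of an enveloping
algebra by the length of words in the modes. -/
def modeSpan (φ : Mode → A) : Submodule ℂ A := Submodule.span ℂ (insert 1 (Set.range φ))

theorem one_mem_modeSpan : 1 ∈ modeSpan φ := Submodule.subset_span (Set.mem_insert _ _)

theorem mem_modeSpan (g : Mode) : φ g ∈ modeSpan φ :=
  Submodule.subset_span (Set.mem_insert_of_mem _ ⟨g, rfl⟩)

theorem ModeRelations.lie_mem_modeSpan (h : ModeRelations k b φ) (g g' : Mode) :
    ⁅φ g, φ g'⁆ ∈ modeSpan φ := by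
  have h_central (c : ℂ) (m n : ℤ) : (if m + n = 0 then c • (1 : A) else 0) ∈ modeSpan φ := by
    split_ifs
    · exact Submodule.smul_mem _ _ one_mem_modeSpan
    · exact zero_mem _
  have h_commute {x y : A} (hxy : Commute x y) : ⁅x, y⁆ ∈ modeSpan φ := by
    rw [hxy.lie_eq]
    exact zero_mem _
  have h_skew {x y : A} (hxy : ⁅x, y⁆ ∈ modeSpan φ) : ⁅y, x⁆ ∈ modeSpan φ := by
    rw [← lie_skew]
    exact neg_mem hxy
  have h_Jp_Jm (m n : ℤ) : ⁅φ (.Jp m), φ (.Jm n)⁆ ∈ modeSpan φ := by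
    rw [h.Jp_Jm]
    exact add_mem (Submodule.smul_mem _ _ (mem_modeSpan _)) (h_central _ _ _)
  have h_J_Jp (m n : ℤ) : ⁅φ (.J m), φ (.Jp n)⁆ ∈ modeSpan φ := by
    rw [h.J_Jp]
    exact Submodule.smul_mem _ _ (mem_modeSpan _)
  have h_J_Jm (m n : ℤ) : ⁅φ (.J m), φ (.Jm n)⁆ ∈ modeSpan φ := by
    rw [h.J_Jm]
    exact neg_mem (Submodule.smul_mem _ _ (mem_modeSpan _))
  have h_J_T (m n : ℤ) : ⁅φ (.J m), φ (.T n)⁆ ∈ modeSpan φ := by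
    rw [h.J_T]
    exact h_central _ _ _
  have h_J_J (m n : ℤ) : ⁅φ (.J m), φ (.J n)⁆ ∈ modeSpan φ := by
    rw [h.J_J]
    exact h_central _ _ _
  rcases g with m | m | m | m <;> rcases g' with n | n | n | n
  exacts [h_commute (h.Jp_Jp m n), h_Jp_Jm m n, h_skew (h_J_Jp n m), h_commute (h.T_Jp n m).symm,
    h_skew (h_Jp_Jm n m), h_commute (h.Jm_Jm m n), h_skew (h_J_Jm n m),
    h_commute (h.T_Jm n m).symm, h_J_Jp m n, h_J_Jm m n, h_J_J m n, h_J_T m n,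
    h_commute (h.T_Jp m n), h_commute (h.T_Jm m n), h_skew (h_J_T n m), h_commute (h.T_T m n)]

theorem lie_mem_pow {L : Submodule ℂ A} {a : A} (h : ∀ x ∈ L, ⁅a, x⁆ ∈ L) (n : ℕ) :
    ∀ x ∈ L ^ n, ⁅a, x⁆ ∈ L ^ n := by
  induction n with
  | zero =>
    intro x hx
    rw [pow_zero, Submodule.mem_one] at hx
    obtain ⟨c, rfl⟩ := hx
    rw [(Algebra.commute_algebraMap_right c a).lie_eq]
    exact zero_mem _
  | succ n ih =>
    intro x hx
    rw [pow_succ] at hx ⊢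
    induction hx using Submodule.mul_induction_on' with
    | mem_mul_mem x hx y hy =>
      have h_leibniz : ⁅a, x * y⁆ = ⁅a, x⁆ * y + x * ⁅a, y⁆ := by
        simp only [Ring.lie_def]
        noncomm_ring
      rw [h_leibniz]
      exact add_mem (Submodule.mul_mem_mul (ih x hx) hy) (Submodule.mul_mem_mul hx (h y hy))
    | add x _ y _ hx hy => rw [lie_add]; exact add_mem hx hy

theorem ModeRelations.lie_mem_modeSpan_pow (h : ModeRelations k b φ) (g : Mode) (n : ℕ) :
    ∀ x ∈ modeSpan φ ^ n, ⁅φ g, x⁆ ∈ modeSpan φ ^ n := by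
  refine lie_mem_pow (fun x hx => ?_) n
  induction hx using Submodule.span_induction with
  | mem x hx =>
    rcases hx with rfl | ⟨g', rfl⟩
    · rw [(Commute.one_right _).lie_eq]
      exact zero_mem _
    · exact h.lie_mem_modeSpan g g'
  | zero => rw [lie_zero]; exact zero_mem _
  | add x y _ _ hx hy => rw [lie_add]; exact add_mem hx hy
  | smul c x _ hx => rw [lie_smul]; exact Submodule.smul_mem _ _ hx

end ModeRelations

section VermaModule

variable {k b : ℝ} {s : Series} {pp pm : ℝ}

theorem Env.induction {C : Env k b → Prop} (h_one : C 1)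
    (h_add : ∀ x y, C x → C y → C (x + y)) (h_smul : ∀ (c : ℂ) x, C x → C (c • x))
    (h_mode : ∀ g x, C x → C (mode k b g * x)) (u : Env k b) : C u := by
  obtain ⟨a, rfl⟩ := RingQuot.mkAlgHom_surjective ℂ (CommRel k b) u
  suffices h : ∀ x, C x → C (RingQuot.mkAlgHom ℂ (CommRel k b) a * x) by
    simpa using h 1 h_one
  induction a using FreeAlgebra.induction with
  | grade0 r => intro x hx; simpa [Algebra.smul_def] using h_smul r x hx
  | grade1 g => intro x hx; exact h_mode g x hx
  | mul a c ha hc => intro x hx; simpa [mul_assoc] using ha _ (hc x hx)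
  | add a c ha hc => intro x hx; simpa [add_mul] using h_add _ _ (ha x hx) (hc x hx)

theorem exists_mem_modeSpan_pow (u : Env k b) : ∃ n, u ∈ modeSpan (mode k b) ^ n := by
  induction u using Env.induction with
  | h_one => exact ⟨0, by rw [pow_zero]; exact Submodule.one_le.1 le_rfl⟩
  | h_add x y hx hy =>
    obtain ⟨m, hx⟩ := hx
    obtain ⟨n, hy⟩ := hy
    have h_mono := pow_right_monotone (Submodule.one_le.2 (one_mem_modeSpan (φ := mode k b)))
    exact ⟨max m n, add_mem (h_mono (le_max_left m n) hx) (h_mono (le_max_right m n) hy)⟩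
  | h_smul c x hx => exact hx.imp fun _ hx => Submodule.smul_mem _ c hx
  | h_mode g x hx =>
    obtain ⟨n, hx⟩ := hx
    exact ⟨n + 1, by rw [pow_succ']; exact Submodule.mul_mem_mul (mem_modeSpan g) hx⟩

theorem exists_smul_vac_eq (x : Verma k b s pp pm) : ∃ u : Env k b, u • vac k b s pp pm = x := by
  obtain ⟨u, rfl⟩ := Submodule.Quotient.mk_surjective _ x
  exact ⟨u, by rw [vac, ← map_smul, smul_eq_mul, mul_one, Submodule.mkQ_apply]⟩

theorem Annihilates.smul_vac {u : Env k b} (hu : Annihilates k b s pp pm u) :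
    u • vac k b s pp pm = 0 := by
  rw [vac, ← map_smul, smul_eq_mul, mul_one, Submodule.mkQ_apply, Submodule.Quotient.mk_eq_zero]
  exact Submodule.subset_span hu

theorem exists_vermaMap {M : Type*} [AddCommGroup M] [Module ℂ M]
    (ρ : Env k b →ₐ[ℂ] Module.End ℂ M) (v : M)
    (hv : ∀ u, Annihilates k b s pp pm u → ρ u v = 0) :
    ∃ F : Verma k b s pp pm →ₗ[ℂ] M,
      F (vac k b s pp pm) = v ∧ ∀ (u : Env k b) x, F (u • x) = ρ u (F x) := by
  let _ : Module (Env k b) M := Module.compHom M ρ.toRingHom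
  have h_smul (u : Env k b) (x : M) : u • x = ρ u x := rfl
  let F : Verma k b s pp pm →ₗ[Env k b] M :=
    (annIdeal k b s pp pm).liftQ (LinearMap.toSpanSingleton (Env k b) M v) (by
      rw [annIdeal, Submodule.span_le]
      intro u hu
      simpa [h_smul] using hv u hu)
  have hF_smul (u : Env k b) (x) : F (u • x) = ρ u (F x) := by rw [map_smul, h_smul]
  refine ⟨{ toFun := F, map_add' := map_add F, map_smul' := fun c x => ?_ }, ?_, hF_smul⟩
  · rw [← algebraMap_smul (Env k b) c x, hF_smul, AlgHom.commutes, Module.algebraMap_end_apply,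
      RingHom.id_apply]
  · change F (vac k b s pp pm) = v
    rw [vac, Submodule.mkQ_apply, Submodule.liftQ_apply, LinearMap.toSpanSingleton_apply, h_smul,
      map_one, Module.End.one_apply]

theorem Mode.conj_conj (g : Mode) : g.conj.conj = g := by
  cases g <;> simp only [Mode.conj, neg_neg]

theorem conj_smul_vac_eq_zero_or_exists_smul_vac (g : Mode) :
    mode k b g.conj • vac k b s pp pm = 0 ∨
      ∃ c : ℂ, mode k b g • vac k b s pp pm = c • vac k b s pp pm := by
  have h_zero {h : Mode} (hh : Annihilates k b s pp pm (mode k b h)) :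
      ∃ c : ℂ, mode k b h • vac k b s pp pm = c • vac k b s pp pm :=
    ⟨0, hh.smul_vac.trans (zero_smul ℂ (vac k b s pp pm)).symm⟩
  have h_weight {h : Mode} {c : ℂ}
      (hh : Annihilates k b s pp pm (mode k b h - algebraMap ℂ (Env k b) c)) :
      ∃ c : ℂ, mode k b h • vac k b s pp pm = c • vac k b s pp pm :=
    ⟨c, by simpa [sub_smul, sub_eq_zero] using hh.smul_vac⟩
  rcases g with n | n | n | n <;> rcases lt_trichotomy n 0 with hn | rfl | hn
  · exact .inl (Annihilates.Jm _ (neg_pos.2 hn)).smul_vac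
  · cases s
    exacts [.inr (h_zero .zero), .inl (Annihilates.zero (s := .lowest)).smul_vac]
  · exact .inr (h_zero (.Jp n hn))
  · exact .inl (Annihilates.Jp _ (neg_pos.2 hn)).smul_vac
  · cases s
    exacts [.inl (Annihilates.zero (s := .highest)).smul_vac, .inr (h_zero .zero)]
  · exact .inr (h_zero (.Jm n hn))
  · exact .inl (Annihilates.J _ (neg_pos.2 hn)).smul_vac
  · exact .inr (h_weight .J_zero)
  · exact .inr (h_zero (.J n hn))
  · exact .inl (Annihilates.T _ (neg_pos.2 hn)).smul_vac
  · exact .inr (h_weight .T_zero)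
  · exact .inr (h_zero (.T n hn))

end VermaModule

section InnerProduct

variable {k b : ℝ} {s : Series} {pp pm : ℝ}
  {B B' : Verma k b s pp pm →ₗ⋆[ℂ] Verma k b s pp pm →ₗ[ℂ] ℂ}

namespace IsInnerProduct

theorem apply_vac_mode_smul (hB : IsInnerProduct B) (g : Mode) (x : Verma k b s pp pm) :
    B (vac k b s pp pm) (mode k b g • x) = -B (mode k b g.conj • vac k b s pp pm) x := by
  rw [hB.adjoint, g.conj_conj, neg_neg]

theorem vac_smul_vac_eq (hB : IsInnerProduct B) (hB' : IsInnerProduct B') (n : ℕ) :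
    ∀ u ∈ modeSpan (mode k b) ^ n,
      B (vac k b s pp pm) (u • vac k b s pp pm) = B' (vac k b s pp pm) (u • vac k b s pp pm) := by
  induction n with
  | zero =>
    intro u hu
    rw [pow_zero, Submodule.mem_one] at hu
    obtain ⟨c, rfl⟩ := hu
    rw [algebraMap_smul, (B _).map_smul, (B' _).map_smul, hB.normalized, hB'.normalized]
  | succ n ih =>
    intro u hu
    rw [pow_succ'] at hu
    induction hu using Submodule.mul_induction_on' with
    | add x _ y _ hx hy => rw [add_smul, map_add, map_add, hx, hy]
    | mem_mul_mem x hx y hy =>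
      induction hx using Submodule.span_induction with
      | zero => rw [zero_mul, zero_smul, map_zero, map_zero]
      | add x x' _ _ hx hx' => rw [add_mul, add_smul, map_add, map_add, hx, hx']
      | smul c x _ hx => rw [smul_mul_assoc, smul_assoc, (B _).map_smul, (B' _).map_smul, hx]
      | mem x hx =>
        rcases hx with rfl | ⟨g, rfl⟩
        · rw [one_mul]
          exact ih y hy
        rcases conj_smul_vac_eq_zero_or_exists_smul_vac (k := k) (b := b) (s := s) g
          with h_conj | ⟨c, hc⟩
        · rw [mul_smul, hB.apply_vac_mode_smul, hB'.apply_vac_mode_smul, h_conj, map_zero,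
            map_zero, LinearMap.zero_apply]
        · have h_swap : mode k b g * y = y * mode k b g + ⁅mode k b g, y⁆ := by
            rw [Ring.lie_def, add_sub_cancel]
          rw [h_swap, add_smul, mul_smul, hc, smul_comm, map_add, map_add, (B _).map_smul,
            (B' _).map_smul, ih y hy, ih _ ((modeRelations_mode k b).lie_mem_modeSpan_pow g n y hy)]

theorem unique (hB : IsInnerProduct B) (hB' : IsInnerProduct B') : B' = B := by
  refine LinearMap.ext fun x => ?_
  obtain ⟨u, rfl⟩ := exists_smul_vac_eq x
  induction u using Env.induction with
  | h_one =>
    refine LinearMap.ext fun y => ?_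
    obtain ⟨v, rfl⟩ := exists_smul_vac_eq y
    obtain ⟨n, hv⟩ := exists_mem_modeSpan_pow v
    rw [one_smul, hB'.vac_smul_vac_eq hB n v hv]
  | h_add x y hx hy => rw [add_smul, map_add, map_add, hx, hy]
  | h_smul c x hx => rw [smul_assoc, B.map_smulₛₗ, B'.map_smulₛₗ, hx]
  | h_mode g x hx =>
    refine LinearMap.ext fun y => ?_
    rw [mul_smul, hB'.adjoint, hB.adjoint, hx]

end IsInnerProduct

/-- The operators `φ` represent the modes on a space with a Hermitian form `B`, for which they have
the prescribed adjoints, `v` is a normalized highest (lowest) weight vector of weight `(p⁺, p⁻)`,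
and primary states have non-negative norm. Such a space computes the inner product of the Verma
module. -/
structure IsCosetRealization {M : Type*} [AddCommGroup M] [Module ℂ M] (k b : ℝ) (s : Series)
    (pp pm : ℝ) (φ : Mode → Module.End ℂ M) (v : M) (B : M →ₗ⋆[ℂ] M →ₗ[ℂ] ℂ) : Prop where
  relations : ModeRelations k b φ
  Jp_apply : ∀ n > 0, φ (.Jp n) v = 0
  Jm_apply : ∀ n > 0, φ (.Jm n) v = 0
  J_apply : ∀ n > 0, φ (.J n) v = 0
  T_apply : ∀ n > 0, φ (.T n) v = 0
  zeroMode_apply : φ s.zeroMode v = 0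
  T_zero_apply : φ (.T 0) v = (Complex.I * pp) • v
  J_zero_apply : φ (.J 0) v = (Complex.I * pm) • v
  hermitian : ∀ x y, starRingEnd ℂ (B x y) = B y x
  adjoint : ∀ g, IsFormAdjoint B (φ g) (-φ g.conj)
  normalized : B v v = 1
  primary_nonneg : ∀ x, (∀ n > 0, φ (.J n) x = φ (.T n) x) → 0 ≤ (B x x).re

namespace IsCosetRealization

variable {M : Type*} [AddCommGroup M] [Module ℂ M] {φ : Mode → Module.End ℂ M} {v : M}
  {B : M →ₗ⋆[ℂ] M →ₗ[ℂ] ℂ}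

theorem lift_apply_eq_zero (h : IsCosetRealization k b s pp pm φ v B) {u : Env k b}
    (hu : Annihilates k b s pp pm u) : h.relations.lift u v = 0 := by
  cases hu <;> simp only [map_sub, h.relations.lift_mode, AlgHom.commutes, LinearMap.sub_apply,
    Module.algebraMap_end_apply]
  case Jp n hn => exact h.Jp_apply n hn
  case Jm n hn => exact h.Jm_apply n hn
  case J n hn => exact h.J_apply n hn
  case T n hn => exact h.T_apply n hn
  case zero => exact h.zeroMode_apply
  case T_zero => exact sub_eq_zero.2 h.T_zero_apply
  case J_zero => exact sub_eq_zero.2 h.J_zero_apply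

theorem cosetUnitary (h : IsCosetRealization k b s pp pm φ v B) : CosetUnitary k b s pp pm := by
  obtain ⟨F, hF_vac, hF_smul⟩ := exists_vermaMap h.relations.lift v fun _ => h.lift_apply_eq_zero
  have hF_mode (g : Mode) (x) : F (mode k b g • x) = φ g (F x) := by
    rw [hF_smul, h.relations.lift_mode]
  have h_inner : IsInnerProduct ((B.comp F).compl₂ F) := by
    refine ⟨fun x y => h.hermitian (F x) (F y), fun g x y => ?_, ?_⟩
    · simp only [LinearMap.compl₂_apply, LinearMap.comp_apply, hF_mode]
      rw [h.adjoint g, LinearMap.neg_apply, map_neg]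
    · simp only [LinearMap.compl₂_apply, LinearMap.comp_apply, hF_vac, h.normalized]
  refine ⟨_, h_inner, fun B' hB' => h_inner.unique hB', fun ψ hψ => ?_⟩
  refine h.primary_nonneg (F ψ) fun n hn => sub_eq_zero.1 ?_
  have h_X : X k b n • ψ = 0 := hψ n hn
  rw [X, sub_smul] at h_X
  rw [← hF_mode, ← hF_mode, ← map_sub, h_X, map_zero]

theorem flip (h : IsCosetRealization k b .highest pp pm φ v B) :
    IsCosetRealization k b .lowest (-pp) (-pm) (flipModes φ) v B where
  relations := h.relations.flip
  Jp_apply := h.Jm_apply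
  Jm_apply := h.Jp_apply
  J_apply n hn := neg_eq_zero.2 (h.J_apply n hn)
  T_apply n hn := neg_eq_zero.2 (h.T_apply n hn)
  zeroMode_apply := h.zeroMode_apply
  T_zero_apply := by
    rw [flipModes, LinearMap.neg_apply, h.T_zero_apply, ← neg_smul]
    push_cast
    ring_nf
  J_zero_apply := by
    rw [flipModes, LinearMap.neg_apply, h.J_zero_apply, ← neg_smul]
    push_cast
    ring_nf
  hermitian := h.hermitian
  adjoint
    | .Jp n => h.adjoint (.Jm n)
    | .Jm n => h.adjoint (.Jp n)
    | .J n => fun x y => by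
      simpa [flipModes, Mode.conj] using congrArg Neg.neg (h.adjoint (.J n) x y)
    | .T n => fun x y => by
      simpa [flipModes, Mode.conj] using congrArg Neg.neg (h.adjoint (.T n) x y)
  normalized := h.normalized
  primary_nonneg x hx := h.primary_nonneg x fun n hn => neg_injective (hx n hn)

end IsCosetRealization

end InnerProduct

theorem lie_add_left_of_commute {A : Type*} [Ring A] {t z : A} (h : Commute t z) (x : A) :
    ⁅x + t, z⁆ = ⁅x, z⁆ := by
  rw [add_lie, h.lie_eq, add_zero]

section NullCurrent

variable {A : Type*} [Ring A] [Algebra ℂ A] {x y : ℤ → A} {c κ : ℂ}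

theorem lie_nullCurrent (hx : ∀ m n, ⁅x m, x n⁆ = if m + n = 0 then (κ * m) • (1 : A) else 0)
    (hxy : ∀ m n, Commute (x m) (y n)) (m n : ℤ) :
    ⁅x m, c • (y n - x n)⁆ = if m + n = 0 then (-c * κ * m) • 1 else 0 := by
  rw [lie_smul, lie_sub, (hxy m n).lie_eq, zero_sub, hx]
  split_ifs
  · module
  · rw [neg_zero, smul_zero]

theorem commute_nullCurrent (hx : ∀ m n, ⁅x m, x n⁆ = if m + n = 0 then (κ * m) • (1 : A) else 0)
    (hy : ∀ m n, ⁅y m, y n⁆ = if m + n = 0 then (-κ * m) • (1 : A) else 0)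
    (hxy : ∀ m n, Commute (x m) (y n)) (m n : ℤ) :
    Commute (c • (y m - x m)) (c • (y n - x n)) := by
  refine Commute.smul_left (Commute.smul_right ?_ c) c
  rw [commute_iff_lie_eq, sub_lie, lie_sub, lie_sub, hy, hx, (hxy m n).lie_eq,
    (hxy n m).symm.lie_eq]
  split_ifs
  · module
  · simp only [sub_self]

theorem lie_add_of_commute {t : ℤ → A} {τ : ℂ}
    (hx : ∀ m n, ⁅x m, x n⁆ = if m + n = 0 then (κ * m) • (1 : A) else 0)
    (hxt : ∀ m n, ⁅x m, t n⁆ = if m + n = 0 then (τ * m) • (1 : A) else 0)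
    (htt : ∀ m n, Commute (t m) (t n)) (m n : ℤ) :
    ⁅x m + t m, x n + t n⁆ = if m + n = 0 then ((κ + 2 * τ) * m) • 1 else 0 := by
  rw [add_lie, lie_add, lie_add, hx, hxt, (htt m n).lie_eq, ← lie_skew, hxt, add_comm n m]
  split_ifs with h
  · rw [show n = -m by omega]
    push_cast
    module
  · simp only [neg_zero, add_zero]

theorem commute_smul_sub_of_lie_eq {x y z : A} (h : ⁅y, z⁆ = ⁅x, z⁆) (c : ℂ) :
    Commute (c • (y - x)) z :=
  Commute.smul_left (commute_iff_lie_eq.2 (by rw [sub_lie, h, sub_self])) c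

end NullCurrent

theorem smul_add_smul_one_lie {A : Type*} [Ring A] [Algebra ℂ A] (z a : ℂ) (x y : A) :
    ⁅z • (a • 1 + x), y⁆ = z • ⁅x, y⁆ := by
  rw [smul_lie, add_lie, smul_lie, (Commute.one_left y).lie_eq, smul_zero, zero_add]

theorem smul_add_smul_one_sub {A : Type*} [Ring A] [Algebra ℂ A] (z a a' : ℂ) (x : A) :
    z • (a • 1 + x) - z • (a' • 1 + x) = (z * (a - a')) • 1 := by
  module

section ChargedZeroMode

open MvPolynomial

variable {σ : Type*} (lam q : σ → ℝ) (a : ℝ)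

/-- The zero mode of a current measuring the charge `q`, with value `i a` on the vacuum. -/
noncomputable def chargeZeroMode : Module.End ℂ (MvPolynomial σ ℂ) :=
  Complex.I • ((a : ℂ) • 1 + chargeOp q)

theorem chargeZeroMode_one : chargeZeroMode q a 1 = (Complex.I * a) • 1 := by
  have h_charge : chargeOp q (1 : MvPolynomial σ ℂ) = 0 := Derivation.map_one_eq_zero _
  rw [chargeZeroMode, LinearMap.smul_apply, LinearMap.add_apply, h_charge, add_zero,
    LinearMap.smul_apply, Module.End.one_apply, smul_smul]

theorem lie_chargeZeroMode_ladder (b : Bool) (i : σ) :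
    ⁅chargeZeroMode q a, ladder lam b i⁆ =
      (Complex.I * if b then (q i : ℂ) else -q i) • ladder lam b i := by
  refine (smul_add_smul_one_lie _ _ _ _).trans ?_
  rw [lie_chargeOp_ladder, smul_smul]

theorem isFormAdjoint_chargeZeroMode :
    IsFormAdjoint (fockForm lam) (chargeZeroMode q a) (-chargeZeroMode q a) := by
  have h := IsFormAdjoint.one (B := fockForm lam).smul (a : ℂ)
  rw [Complex.conj_ofReal] at h
  exact (h.add (isFormAdjoint_chargeOp lam q)).smul_I

theorem lie_bosonMode_chargeZeroMode_ladder {ι : ℕ → σ} {i : σ} (hi : ∀ j, ι j ≠ i) (b : Bool)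
    (m : ℤ) : ⁅bosonMode lam ι (chargeZeroMode q a) m, ladder lam b i⁆ =
      if m = 0 then (Complex.I * if b then (q i : ℂ) else -q i) • ladder lam b i else 0 := by
  rcases eq_or_ne m 0 with rfl | hm
  · rw [bosonMode_zero, if_pos rfl, lie_chargeZeroMode_ladder]
  · rw [bosonMode, if_neg hm, if_neg hm, ← commute_iff_lie_eq]
    exact commute_ladder lam fun h => (hi _ h).elim

end ChargedZeroMode

section FreeField

open MvPolynomial

/-- The oscillators of the free field realization: those of two neutral free bosons `X`, `Y` and
those of a charged field. The oscillators `X 0` and `Y 0` have norm zero and are not used. -/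
inductive Osc : Type
  | X (n : ℕ)
  | Y (n : ℕ)
  | P (n : ℤ)

variable (k b p pm : ℝ)

/-- The squared norms of the oscillators in the realization with `T₀ = i p`. -/
noncomputable def Osc.sqNorm : Osc → ℝ
  | .X n => -(k * (b - 2) / 2) * n
  | .Y n => -(-(k * (b - 2) / 2)) * n
  | .P n => if n < 0 then k * n - 2 * p else 2 * p - k * n

/-- The charges of the oscillators under `-i J₀`. -/
noncomputable def Osc.charge : Osc → ℝ
  | .P n => if n < 0 then 1 else -1
  | _ => 0

/-- The energies of the oscillators of the neutral bosons. The charged oscillators count for zero,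
so that positive modes of the null current strictly lower the energy. -/
def Osc.energy : Osc → ℕ
  | .X n => n
  | .Y n => n
  | .P _ => 0

/-- The modes of the timelike current `X = J - T`. -/
noncomputable def modeX : ℤ → Module.End ℂ (MvPolynomial Osc ℂ) :=
  bosonMode (Osc.sqNorm k b p) .X (chargeZeroMode Osc.charge (pm - p))

/-- The modes of the spacelike current `Y`, normalized so that `Y - X` is null. -/
noncomputable def modeY : ℤ → Module.End ℂ (MvPolynomial Osc ℂ) :=
  bosonMode (Osc.sqNorm k b p) .Y (chargeZeroMode Osc.charge (pm - p + (2 - b) * p))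

/-- The modes of the null current `T`. -/
noncomputable def modeT (n : ℤ) : Module.End ℂ (MvPolynomial Osc ℂ) :=
  (((2 - b)⁻¹ : ℝ) : ℂ) • (modeY k b p pm n - modeX k b p pm n)

/-- The modes of the free field of charge `1`. -/
noncomputable def modePp (n : ℤ) : Module.End ℂ (MvPolynomial Osc ℂ) :=
  ladder (Osc.sqNorm k b p) (decide (n < 0)) (.P n)

/-- The modes of the free field of charge `-1`. -/
noncomputable def modePm (n : ℤ) : Module.End ℂ (MvPolynomial Osc ℂ) :=
  ladder (Osc.sqNorm k b p) (decide (n ≤ 0)) (.P (-n))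

variable {k b p pm}

theorem commute_chargeZeroMode_neutral {a : ℝ} {o : Osc} (ho : o.charge = 0) (c : Bool) :
    Commute (chargeZeroMode Osc.charge a) (ladder (Osc.sqNorm k b p) c o) := by
  rw [commute_iff_lie_eq, lie_chargeZeroMode_ladder, ho]
  simp

theorem lie_modeX_modeX (m n : ℤ) : ⁅modeX k b p pm m, modeX k b p pm n⁆ =
    if m + n = 0 then ((k * (b - 2) / 2 : ℝ) * m : ℂ) • 1 else 0 :=
  lie_bosonMode (fun _ _ => Osc.X.inj) (fun _ => rfl)
    (fun _ _ => commute_chargeZeroMode_neutral rfl _) m n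

theorem lie_modeY_modeY (m n : ℤ) : ⁅modeY k b p pm m, modeY k b p pm n⁆ =
    if m + n = 0 then (-(k * (b - 2) / 2 : ℝ) * m : ℂ) • 1 else 0 := by
  rw [← Complex.ofReal_neg]
  exact lie_bosonMode (fun _ _ => Osc.Y.inj) (fun _ => rfl)
    (fun _ _ => commute_chargeZeroMode_neutral rfl _) m n

theorem commute_modeX_modeY (m n : ℤ) : Commute (modeX k b p pm m) (modeY k b p pm n) := by
  have h_zero (a a' : ℝ) :
      Commute (chargeZeroMode Osc.charge a) (chargeZeroMode Osc.charge a') := by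
    have h_charge (a : ℝ) : Commute ((a : ℂ) • 1 + chargeOp Osc.charge) (chargeOp Osc.charge) :=
      ((Commute.one_left _).smul_left _).add_left (Commute.refl _)
    exact Commute.smul_left (Commute.smul_right
      (((Commute.one_right _).smul_right _).add_right (h_charge a)) _) _
  exact commute_bosonMode_bosonMode (fun _ _ h => Osc.noConfusion h) (h_zero _ _)
    (fun _ _ => commute_chargeZeroMode_neutral rfl _)
    (fun _ _ => commute_chargeZeroMode_neutral rfl _) m n

theorem commute_modeT_modeT (m n : ℤ) : Commute (modeT k b p pm m) (modeT k b p pm n) :=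
  commute_nullCurrent lie_modeX_modeX lie_modeY_modeY commute_modeX_modeY m n

theorem lie_modeX_modeT (hb : b ≠ 2) (m n : ℤ) : ⁅modeX k b p pm m, modeT k b p pm n⁆ =
    if m + n = 0 then (k / 2 * m : ℂ) • 1 else 0 := by
  have hb' : (2 - b : ℂ) ≠ 0 := by exact_mod_cast sub_ne_zero.2 hb.symm
  refine (lie_nullCurrent lie_modeX_modeX commute_modeX_modeY m n).trans ?_
  congr 3
  push_cast
  field_simp
  ring

theorem modeT_zero (hb : b ≠ 2) : modeT k b p pm 0 = (Complex.I * p) • 1 := by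
  have hb' : (2 - b : ℂ) ≠ 0 := by exact_mod_cast sub_ne_zero.2 hb.symm
  rw [modeT, modeY, modeX, bosonMode_zero, bosonMode_zero, chargeZeroMode, chargeZeroMode]
  refine (congrArg _ (smul_add_smul_one_sub _ _ _ _)).trans ?_
  rw [smul_smul]
  congr 1
  push_cast
  field_simp
  ring

theorem modeT_apply_one {n : ℤ} (hn : 0 < n) : modeT k b p pm n 1 = 0 := by
  rw [modeT, LinearMap.smul_apply, LinearMap.sub_apply, modeY, modeX, bosonMode_apply_one hn,
    bosonMode_apply_one hn, sub_zero, smul_zero]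

theorem lie_modeX_ladder (m n : ℤ) (c : Bool) :
    ⁅modeX k b p pm m, ladder (Osc.sqNorm k b p) c (.P n)⁆ =
      if m = 0 then (Complex.I * if c then (Osc.charge (.P n) : ℂ) else -Osc.charge (.P n)) •
        ladder (Osc.sqNorm k b p) c (.P n) else 0 :=
  lie_bosonMode_chargeZeroMode_ladder _ _ _ (fun _ h => Osc.noConfusion h) c m

theorem commute_modeT_ladder (m n : ℤ) (c : Bool) :
    Commute (modeT k b p pm m) (ladder (Osc.sqNorm k b p) c (.P n)) := by
  refine commute_smul_sub_of_lie_eq ?_ _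
  rw [lie_modeX_ladder]
  exact lie_bosonMode_chargeZeroMode_ladder _ _ _ (fun _ h => Osc.noConfusion h) c m

theorem lie_modeX_modePp (m n : ℤ) : ⁅modeX k b p pm m, modePp k b p n⁆ =
    if m = 0 then (Complex.I * (1 : ℝ)) • modePp k b p n else 0 := by
  rw [modePp, lie_modeX_ladder]
  by_cases hn : n < 0 <;> simp [Osc.charge, hn]

theorem lie_modeX_modePm (m n : ℤ) : ⁅modeX k b p pm m, modePm k b p n⁆ =
    if m = 0 then (Complex.I * (-1 : ℝ)) • modePm k b p n else 0 := by
  rw [modePm, lie_modeX_ladder]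
  by_cases hn : n ≤ 0
  · simp [Osc.charge, hn, hn.not_gt]
  · simp [Osc.charge, hn, not_le.1 hn]

theorem lie_modePp_modePm (hb : b ≠ 2) (m n : ℤ) : ⁅modePp k b p m, modePm k b p n⁆ =
    if m + n = 0 then (2 * Complex.I * (1 : ℝ)) • modeT k b p pm 0 + (k * m : ℂ) • 1 else 0 := by
  classical
  have h_iff : Osc.P m = .P (-n) ∧ decide (m < 0) ≠ decide (n ≤ 0) ↔ m + n = 0 := by
    rw [Osc.P.injEq, Ne, decide_eq_decide]
    omega
  rw [modePp, modePm, lie_ladder, modeT_zero hb, smul_smul, ← add_smul]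
  simp only [h_iff]
  congr 2
  have hI : 2 * Complex.I * (1 : ℝ) * (Complex.I * p) = -(2 * p) := by
    rw [Complex.ofReal_one]
    linear_combination (2 * p : ℂ) * Complex.I_mul_I
  rw [hI]
  by_cases hm : m < 0 <;> simp [Osc.sqNorm, hm] <;> ring

theorem commute_modePp_modePp (m n : ℤ) : Commute (modePp k b p m) (modePp k b p n) :=
  commute_ladder _ fun h => by rw [Osc.P.inj h]

theorem commute_modePm_modePm (m n : ℤ) : Commute (modePm k b p m) (modePm k b p n) :=
  commute_ladder _ fun h => by rw [neg_injective (Osc.P.inj h)]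

theorem eventually_modePp_apply_eq_zero (f : MvPolynomial Osc ℂ) :
    ∀ᶠ n in Filter.atTop, modePp k b p n f = 0 := by
  filter_upwards [eventually_ladder_false_eq_zero _ (fun _ _ => Osc.P.inj) f,
    Filter.eventually_ge_atTop 0] with n h hn
  rwa [modePp, decide_eq_false hn.not_gt]

theorem eventually_modePm_apply_eq_zero (f : MvPolynomial Osc ℂ) :
    ∀ᶠ n in Filter.atTop, modePm k b p n f = 0 := by
  filter_upwards [eventually_ladder_false_eq_zero _ (ι := fun n => .P (-n))
    (fun _ _ h => neg_injective (Osc.P.inj h)) f, Filter.eventually_gt_atTop 0] with n h hn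
  rwa [modePm, decide_eq_false hn.not_ge]

theorem isFormAdjoint_modePp (n : ℤ) :
    IsFormAdjoint (fockForm (Osc.sqNorm k b p)) (modePp k b p n) (-modePm k b p (-n)) := by
  have h_not : decide (-n ≤ 0) = !decide (n < 0) := by
    rw [← decide_not, decide_eq_decide]
    omega
  rw [modePp, modePm, h_not, neg_neg]
  exact isFormAdjoint_ladder _ _ _

theorem isFormAdjoint_modeX (n : ℤ) :
    IsFormAdjoint (fockForm (Osc.sqNorm k b p)) (modeX k b p pm n) (-modeX k b p pm (-n)) :=
  isFormAdjoint_bosonMode (isFormAdjoint_chargeZeroMode _ _ _) n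

theorem isFormAdjoint_modeT (n : ℤ) :
    IsFormAdjoint (fockForm (Osc.sqNorm k b p)) (modeT k b p pm n) (-modeT k b p pm (-n)) := by
  have h_Y : IsFormAdjoint (fockForm (Osc.sqNorm k b p)) (modeY k b p pm n)
      (-modeY k b p pm (-n)) :=
    isFormAdjoint_bosonMode (isFormAdjoint_chargeZeroMode _ _ _) n
  exact h_Y.smul_sub_neg (isFormAdjoint_modeX n) _

theorem modeT_mem_weightLT (l d : ℕ) {f : MvPolynomial Osc ℂ} (hf : f ∈ weightLT Osc.energy d) :
    modeT k b p pm (l + 1 : ℕ) f ∈ weightLT Osc.energy (d - (l + 1)) := by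
  have h_ladder {o : Osc} (ho : o.energy = l + 1) :
      ladder (Osc.sqNorm k b p) false o f ∈ weightLT Osc.energy (d - (l + 1)) :=
    ho ▸ ladder_false_mem_weightLT _ o hf
  rw [modeT, modeY, modeX, bosonMode_of_pos (by omega), bosonMode_of_pos (by omega),
    Int.natAbs_natCast, LinearMap.smul_apply, LinearMap.sub_apply]
  exact Submodule.smul_mem _ _ (sub_mem (h_ladder rfl) (h_ladder rfl))

theorem eventually_vertexOp_modeT_apply_eq_zero (η : ℝ) (f : MvPolynomial Osc ℂ) :
    ∀ᶠ j in Filter.atTop, vertexOp k (modeT k b p pm) 1 η j f = 0 := by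
  obtain ⟨d, hd⟩ := exists_mem_weightLT Osc.energy f
  filter_upwards [Filter.eventually_ge_atTop d] with j hj
  have h_mem := vertexOp_mem (k := k) (T := modeT k b p pm) (ε := 1) (η := η)
    (F := weightLT Osc.energy)
    (fun l d f hf => by simpa using modeT_mem_weightLT l d hf) j d f hd
  rwa [Nat.sub_eq_zero_of_le hj, weightLT_zero, Submodule.mem_bot] at h_mem

theorem fockForm_self_nonneg_of_modeX_eq_zero (hk : k < 0) (hb : b < 2) (hp : 0 ≤ p)
    (hpk : p ≤ -k / 2) {f : MvPolynomial Osc ℂ} (hf : ∀ n > 0, modeX k b p pm n f = 0) :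
    0 ≤ (fockForm (Osc.sqNorm k b p) f f).re := by
  have hκ : 0 < k * (b - 2) / 2 := half_pos (mul_pos_of_neg_of_neg hk (sub_neg.2 hb))
  refine fockForm_self_nonneg _ fun m hm i hi => ?_
  rcases i with n | n | n
  · obtain rfl : n = 0 := by
      by_contra hn
      have h_annihilate := hf n (by omega)
      rw [modeX, bosonMode_of_pos (by omega)] at h_annihilate
      refine hi (eq_zero_of_mem_support_of_ladder_false_eq_zero _ ?_ h_annihilate hm)
      exact mul_ne_zero (neg_ne_zero.2 hκ.ne') (Nat.cast_ne_zero.2 hn)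
    exact (mul_eq_zero_of_right _ Nat.cast_zero).ge
  · rw [Osc.sqNorm, neg_neg]
    positivity
  · rw [Osc.sqNorm]
    split_ifs with hn
    · have hn' : (n : ℝ) ≤ -1 := by exact_mod_cast Int.le_sub_one_of_lt hn
      nlinarith
    · have hn' : (0 : ℝ) ≤ n := by exact_mod_cast not_lt.1 hn
      nlinarith

end FreeField

section Realization

open MvPolynomial

variable {k b p pm : ℝ} {Jp Jm : ℤ → Module.End ℂ (MvPolynomial Osc ℂ)}

/-- The free field realization of the modes, for given modes `Jp` and `Jm` of the dressed charged
fields. -/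
noncomputable def freeFieldModes (k b p pm : ℝ) (Jp Jm : ℤ → Module.End ℂ (MvPolynomial Osc ℂ)) :
    Mode → Module.End ℂ (MvPolynomial Osc ℂ)
  | .Jp n => Jp n
  | .Jm n => Jm n
  | .J n => modeX k b p pm n + modeT k b p pm n
  | .T n => modeT k b p pm n

local instance : TopologicalSpace (MvPolynomial Osc ℂ) := ⊥

local instance : DiscreteTopology (MvPolynomial Osc ℂ) := ⟨rfl⟩

theorem lie_modeX_add_modeT_of_isVertexDressing {η : ℝ}
    {Q Q' : ℤ → Module.End ℂ (MvPolynomial Osc ℂ)}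
    (h : IsVertexDressing k (modeT k b p pm) η Q Q') (hk : k ≠ 0) (hb : b ≠ 2)
    (hTQ : ∀ m n, Commute (modeT k b p pm m) (Q n))
    (hXQ : ∀ m n, ⁅modeX k b p pm m, Q n⁆ = if m = 0 then (Complex.I * η) • Q n else 0) (m n : ℤ) :
    ⁅modeX k b p pm m + modeT k b p pm m, Q' n⁆ = (Complex.I * η) • Q' (m + n) := by
  rw [lie_add_left_of_commute (h.commute (commute_modeT_modeT m) (hTQ m) n)]
  exact h.lie hk (lie_modeX_modeT hb m) (hXQ m) n

theorem modeRelations_freeFieldModes (hk : k ≠ 0) (hb : b ≠ 2)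
    (hp : IsVertexDressing k (modeT k b p pm) 1 (modePp k b p) Jp)
    (hm : IsVertexDressing k (modeT k b p pm) (-1) (modePm k b p) Jm) :
    ModeRelations k b (freeFieldModes k b p pm Jp Jm) where
  Jp_Jm m n := by
    simpa only [freeFieldModes, Complex.ofReal_one, mul_one] using
      IsVertexDressing.lie_neg hk commute_modeT_modeT
        (fun _ _ => commute_modeT_ladder _ _ _) (fun _ _ => commute_modeT_ladder _ _ _)
        (lie_modePp_modePm hb) hp hm m n
  J_Jp m n := by
    simpa only [freeFieldModes, Complex.ofReal_one, mul_one] using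
      lie_modeX_add_modeT_of_isVertexDressing hp hk hb (fun _ _ => commute_modeT_ladder _ _ _)
        lie_modeX_modePp m n
  J_Jm m n := by
    have h := lie_modeX_add_modeT_of_isVertexDressing hm hk hb
      (fun _ _ => commute_modeT_ladder _ _ _) lie_modeX_modePm m n
    rw [Complex.ofReal_neg, Complex.ofReal_one, mul_neg_one] at h
    exact h.trans (neg_smul (M := Module.End ℂ (MvPolynomial Osc ℂ)) Complex.I (Jm (m + n)))
  J_T m n := (lie_add_left_of_commute (commute_modeT_modeT m n) _).trans (lie_modeX_modeT hb m n)
  J_J m n := by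
    refine (lie_add_of_commute lie_modeX_modeX (lie_modeX_modeT hb) commute_modeT_modeT m n).trans
      ?_
    congr 3
    push_cast
    ring
  Jp_Jp := hp.commute_commute hp commute_modeT_modeT (fun _ _ => commute_modeT_ladder _ _ _)
    (fun _ _ => commute_modeT_ladder _ _ _) commute_modePp_modePp
  Jm_Jm := hm.commute_commute hm commute_modeT_modeT (fun _ _ => commute_modeT_ladder _ _ _)
    (fun _ _ => commute_modeT_ladder _ _ _) commute_modePm_modePm
  T_Jp m n := hp.commute (commute_modeT_modeT m) (fun _ => commute_modeT_ladder _ _ _) n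
  T_Jm m n := hm.commute (commute_modeT_modeT m) (fun _ => commute_modeT_ladder _ _ _) n
  T_T := commute_modeT_modeT

theorem isFormAdjoint_freeFieldModes
    (hp : IsVertexDressing k (modeT k b p pm) 1 (modePp k b p) Jp)
    (hm : IsVertexDressing k (modeT k b p pm) (-1) (modePm k b p) Jm) (g : Mode) :
    IsFormAdjoint (fockForm (Osc.sqNorm k b p)) (freeFieldModes k b p pm Jp Jm g)
      (-freeFieldModes k b p pm Jp Jm g.conj) := by
  have h_Jp (n : ℤ) : IsFormAdjoint (fockForm (Osc.sqNorm k b p)) (Jp n) (-Jm (-n)) :=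
    hp.isFormAdjoint hm commute_modeT_modeT (fun _ _ => commute_modeT_ladder _ _ _)
      isFormAdjoint_modeT isFormAdjoint_modePp n
  cases g with
  | Jp n => exact h_Jp n
  | Jm n =>
    have h := (isFormAdjoint_fockForm_symm _ (h_Jp (-n))).neg
    rwa [neg_neg, neg_neg] at h
  | J n => exact (isFormAdjoint_modeX n).add_neg (isFormAdjoint_modeT n)
  | T n => exact isFormAdjoint_modeT n

theorem isCosetRealization_freeFieldModes (hk : k < 0) (hb : b < 2) (hp : 0 ≤ p) (hpk : p ≤ -k / 2)
    (hJp : IsVertexDressing k (modeT k b p pm) 1 (modePp k b p) Jp)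
    (hJm : IsVertexDressing k (modeT k b p pm) (-1) (modePm k b p) Jm) :
    IsCosetRealization k b .highest p pm (freeFieldModes k b p pm Jp Jm) 1
      (fockForm (Osc.sqNorm k b p)) := by
  have h_Jp (n : ℤ) (hn : 0 ≤ n) : Jp n 1 = 0 :=
    hJp.apply_eq_zero commute_modeT_modeT (fun _ _ => commute_modeT_ladder _ _ _)
      (fun l => modeT_apply_one (by omega))
      fun m hm => by rw [modePp, decide_eq_false (by omega), ladder_false_one]
  have h_Jm (n : ℤ) (hn : 0 < n) : Jm n 1 = 0 :=
    hJm.apply_eq_zero commute_modeT_modeT (fun _ _ => commute_modeT_ladder _ _ _)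
      (fun l => modeT_apply_one (by omega))
      fun m hm => by rw [modePm, decide_eq_false (by omega), ladder_false_one]
  have h_T : modeT k b p pm 0 1 = (Complex.I * p) • 1 := by
    rw [modeT_zero hb.ne]
    rfl
  refine ⟨modeRelations_freeFieldModes hk.ne hb.ne hJp hJm, fun n hn => h_Jp n hn.le, h_Jm,
    fun n hn => ?_, fun n hn => modeT_apply_one hn, h_Jp 0 le_rfl, h_T, ?_, fockForm_hermitian _,
    isFormAdjoint_freeFieldModes hJp hJm, fockForm_one _, fun f hf => ?_⟩
  · rw [freeFieldModes, LinearMap.add_apply, modeT_apply_one hn, modeX, bosonMode_apply_one hn,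
      add_zero]
  · rw [freeFieldModes, LinearMap.add_apply, h_T, modeX, bosonMode_zero, chargeZeroMode_one,
      ← add_smul]
    push_cast
    ring_nf
  · exact fockForm_self_nonneg_of_modeX_eq_zero (pm := pm) hk hb hp hpk fun n hn =>
      add_eq_right.1 (hf n hn)

theorem exists_isCosetRealization_highest (hk : k < 0) (hb : b < 2) (hp : 0 ≤ p)
    (hpk : p ≤ -k / 2) : ∃ φ, IsCosetRealization k b .highest p pm φ (1 : MvPolynomial Osc ℂ)
      (fockForm (Osc.sqNorm k b p)) := by
  obtain ⟨Jp, hJp⟩ := exists_isVertexDressing (Q := modePp k b p) (η := 1)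
    (commute_modeT_modeT (pm := pm)) (fun m n => commute_modeT_ladder m n _)
    eventually_modePp_apply_eq_zero (eventually_vertexOp_modeT_apply_eq_zero 1)
  obtain ⟨Jm, hJm⟩ := exists_isVertexDressing (Q := modePm k b p) (η := -1)
    (commute_modeT_modeT (pm := pm)) (fun m n => commute_modeT_ladder m (-n) _)
    eventually_modePm_apply_eq_zero (eventually_vertexOp_modeT_apply_eq_zero (-1))
  exact ⟨_, isCosetRealization_freeFieldModes hk hb hp hpk hJp hJm⟩

end Realization

end NappiWitten

theorem mainTheorem2_general (k b : ℝ) (hk : k < 0) (hb : b < 2) (pp pm : ℝ) :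
    (0 ≤ pp → pp ≤ -k / 2 →
      NappiWitten.CosetUnitary k b NappiWitten.Series.highest pp pm) ∧
    (k / 2 ≤ pp → pp ≤ 0 →
      NappiWitten.CosetUnitary k b NappiWitten.Series.lowest pp pm) := by
  refine ⟨fun h_nonneg h_le => ?_, fun h_le h_nonpos => ?_⟩
  · obtain ⟨φ, hφ⟩ := NappiWitten.exists_isCosetRealization_highest hk hb h_nonneg h_le
    exact hφ.cosetUnitary
  · obtain ⟨φ, hφ⟩ := NappiWitten.exists_isCosetRealization_highest (pm := -pm) hk hb
      (neg_nonneg.2 h_nonpos) (by linarith)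
    simpa only [neg_neg] using hφ.flip.cosetUnitary

theorem mainTheorem2 (k : ℝ) (hk : k < 0) (pp pm : ℝ) :
    (0 < pp → pp ≤ -k / 2 →
      NappiWitten.CosetUnitary k (2 / k) NappiWitten.Series.highest pp pm) ∧
    (k / 2 ≤ pp → pp < 0 →
      NappiWitten.CosetUnitary k (2 / k) NappiWitten.Series.lowest pp pm) := by
  have h := mainTheorem2_general k (2 / k) hk
    ((div_neg_of_pos_of_neg two_pos hk).trans two_pos) pp pm
  exact ⟨fun h_pos => h.1 h_pos.le, fun h_le h_neg => h.2 h_le h_neg.le⟩
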